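/- Let $\mathcal G$ be the planar Galilean conformal algebra: the complex Lie algebra with basis $\{L_n,H_n,I_n,J_n\mid n\in\mathbb Z\}$ and brackets $$[L_m,L_n]=(n-m)L_{m+n},\quad [L_m,H_n]=nH_{m+n},\quad [L_m,I_n]=(n-m)I_{m+n},$$ $$[L_m,J_n]=(n-m)J_{m+n},\quad [H_m,I_n]=I_{m+n},\quad [H_m,J_n]=-J_{m+n},$$ all other brackets of basis vectors being determined by skew-symmetry or zero. Put $\mathcal G_n=\mathbb C L_n\oplus\mathbb C H_n\oplus\mathbb C I_n\oplus\mathbb C J_n$. A $\mathcal G$-module $V$ is called restricted if for every $v\in V$ there is $i\in\mathbb N$ such that $\mathcal G_n v=0$ for all $n\ge i$. For $\lambda,\sigma\in\mathbb C^*$ and $\eta\in\mathbb C$ let $\Omega(\lambda,\sigma,\eta)=\mathbb C[s,t]$ and $\Gamma(\lambda,\sigma,\eta)=\mathbb C[x,y]$ be the $\mathcal G$-modules with actions $$L_nf(s,t)=\lambda^n(s-nt+n\eta)f(s-n,t),\quad H_nf(s,t)=\lambda^n t f(s-n,t),\quad I_nf(s,t)=\lambda^n\sigma f(s-n,t-1),\quad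 J_nf(s,t)=0,$$ $$L_ng(x,y)=\lambda^n(x+ny+n\eta)g(x-n,y),\quad H_ng(x,y)=\lambda^n y\, g(x-n,y),\quad I_ng(x,y)=0,\quad J_ng(x,y)=\lambda^n\sigma g(x-n,y+1)$$ for all $n\in\mathbb Z$. Let $m_1,m_2\in\mathbb N$ (possibly $0$), let $\lambda_k,\sigma_k\in\mathbb C^*$ and $\eta_k\in\mathbb C$ for $1\le k\le m_1+m_2$, and let $V$ be an arbitrary simple restricted $\mathcal G$-module. Then the tensor product $\mathcal G$-module $$\left(\bigotimes_{k=1}^{m_1}\Omega(\lambda_k,\sigma_k,\eta_k)\right)\otimes\left(\bigotimes_{k=m_1+1}^{m_1+m_2}\Gamma(\lambda_k,\sigma_k,\eta_k)\right)\otimes V$$ is simple if and only if $\lambda_1,\ldots,\lambda_{m_1+m_2}$ are pairwise distinct. -/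

import Mathlib

open scoped TensorProduct

namespace PlanarGCA

/-- The four families of basis vectors. -/
inductive Gen : Type
  | L
  | H
  | I
  | J

end PlanarGCA

/-- The planar Galilean conformal algebra as a vector space: the complex vector space with basis
`L_n, H_n, I_n, J_n`, `n ∈ ℤ`. -/
def PlanarGCA : Type := PlanarGCA.Gen × ℤ →₀ ℂ

namespace PlanarGCA

noncomputable instance : AddCommGroup PlanarGCA := inferInstanceAs (AddCommGroup (Gen × ℤ →₀ ℂ))

noncomputable instance : Module ℂ PlanarGCA := inferInstanceAs (Module ℂ (Gen × ℤ →₀ ℂ))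

/-- The basis of the algebra, indexed by pairs (family, degree). -/
noncomputable def basis : Module.Basis (Gen × ℤ) ℂ PlanarGCA :=
  Module.Basis.ofRepr (LinearEquiv.refl ℂ (Gen × ℤ →₀ ℂ))

/-- The basis vector of the family `X` in degree `n`. -/
noncomputable def gen (X : Gen) (n : ℤ) : PlanarGCA := basis (X, n)

/-- The bracket of two basis vectors. -/
noncomputable def bracketGen : Gen × ℤ → Gen × ℤ → PlanarGCA
  | (.L, m), (.L, n) => ((n : ℂ) - m) • gen .L (m + n)
  | (.L, m), (.H, n) => (n : ℂ) • gen .H (m + n)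
  | (.L, m), (.I, n) => ((n : ℂ) - m) • gen .I (m + n)
  | (.L, m), (.J, n) => ((n : ℂ) - m) • gen .J (m + n)
  | (.H, m), (.I, n) => gen .I (m + n)
  | (.H, m), (.J, n) => -gen .J (m + n)
  | (.H, m), (.L, n) => -((m : ℂ) • gen .H (n + m))
  | (.I, m), (.L, n) => -(((m : ℂ) - n) • gen .I (n + m))
  | (.J, m), (.L, n) => -(((m : ℂ) - n) • gen .J (n + m))
  | (.I, m), (.H, n) => -gen .I (n + m)
  | (.J, m), (.H, n) => gen .J (n + m)
  | (.H, _), (.H, _) => 0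
  | (.I, _), (.I, _) => 0
  | (.I, _), (.J, _) => 0
  | (.J, _), (.I, _) => 0
  | (.J, _), (.J, _) => 0

/-- The bracket as a bilinear map. -/
noncomputable def bracketLin : PlanarGCA →ₗ[ℂ] PlanarGCA →ₗ[ℂ] PlanarGCA :=
  basis.constr ℂ fun a => basis.constr ℂ fun b => bracketGen a b

theorem bracketLin_gen (X Y : Gen) (m n : ℤ) :
    bracketLin (gen X m) (gen Y n) = bracketGen (X, m) (Y, n) := by
  simp [bracketLin, gen, Module.Basis.constr_basis]

theorem bracketLin_skew (x y : PlanarGCA) : bracketLin x y = -bracketLin y x := by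
  have h : bracketLin = -bracketLin.flip := by
    refine basis.ext fun a => basis.ext fun b => ?_
    obtain ⟨X, m⟩ := a
    obtain ⟨Y, n⟩ := b
    change bracketLin (gen X m) (gen Y n) = -bracketLin (gen Y n) (gen X m)
    rw [bracketLin_gen, bracketLin_gen]
    cases X <;> cases Y <;> simp [bracketGen]
    rw [← neg_smul, add_comm n m]
    congr 1
    ring
  exact congrArg (fun f : PlanarGCA →ₗ[ℂ] PlanarGCA →ₗ[ℂ] PlanarGCA => f x y) h

theorem bracketLin_leibniz_gen (X Y Z : Gen) (m n p : ℤ) :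
    bracketLin (gen X m) (bracketLin (gen Y n) (gen Z p)) =
      bracketLin (bracketLin (gen X m) (gen Y n)) (gen Z p) +
        bracketLin (gen Y n) (bracketLin (gen X m) (gen Z p)) := by
  simp only [bracketLin_gen]
  cases X <;> cases Y <;> cases Z <;>
    simp only [bracketGen, map_smul, map_neg, map_zero, LinearMap.smul_apply,
      LinearMap.neg_apply, LinearMap.zero_apply, bracketLin_gen, smul_zero, neg_zero, add_zero,
      zero_add, smul_smul, smul_neg, neg_neg] <;>
    simp only [show m + (n + p) = m + n + p by ring, show n + (m + p) = m + n + p by ring,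
      show p + (m + n) = m + n + p by ring, show n + (p + m) = m + n + p by ring,
      show m + (p + n) = m + n + p by ring, show p + m + n = m + n + p by ring,
      show p + n + m = m + n + p by ring, show p + (n + m) = m + n + p by ring,
      show n + p + m = m + n + p by ring, show n + m + p = m + n + p by ring,
      show m + p + n = m + n + p by ring] <;>
    push_cast <;> module

theorem bracketLin_leibniz (x y z : PlanarGCA) :
    bracketLin x (bracketLin y z) =
      bracketLin (bracketLin x y) z + bracketLin y (bracketLin x z) := by
  have key : ∀ x y, bracketLin x ∘ₗ bracketLin y =
      bracketLin (bracketLin x y) + bracketLin y ∘ₗ bracketLin x := by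
    intro x y
    have hx : x ∈ Submodule.span ℂ (Set.range basis) := by simp [basis.span_eq]
    have hy : y ∈ Submodule.span ℂ (Set.range basis) := by simp [basis.span_eq]
    induction hx, hy using Submodule.span_induction₂ with
    | mem_mem a b ha hb =>
      obtain ⟨⟨X, m⟩, rfl⟩ := ha
      obtain ⟨⟨Y, n⟩, rfl⟩ := hb
      refine basis.ext fun c => ?_
      exact bracketLin_leibniz_gen X Y c.1 m n c.2
    | zero_left b hb => simp
    | zero_right a ha => simp
    | add_left a b c _ _ _ h1 h2 =>
      simp only [map_add, LinearMap.add_comp, LinearMap.add_apply, LinearMap.comp_add, h1, h2]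
      abel
    | add_right a b c _ _ _ h1 h2 =>
      simp only [map_add, LinearMap.add_comp, LinearMap.comp_add, h1, h2]
      abel
    | smul_left r a b _ _ h =>
      simp only [map_smul, LinearMap.smul_comp, LinearMap.smul_apply, LinearMap.comp_smul, h,
        smul_add]
    | smul_right r a b _ _ h =>
      simp only [map_smul, LinearMap.smul_comp, LinearMap.comp_smul, h, smul_add]
  exact congrArg (fun f : PlanarGCA →ₗ[ℂ] PlanarGCA => f z) (key x y)

noncomputable instance : LieRing PlanarGCA where
  bracket x y := bracketLin x y
  add_lie x y z := by
    change bracketLin (x + y) z = _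
    rw [map_add]; rfl
  lie_add x y z := map_add (bracketLin x) y z
  lie_self x := by
    have h := bracketLin_skew x x
    have h2 : (2 : ℂ) • bracketLin x x = 0 := by
      rw [two_smul]
      exact eq_neg_iff_add_eq_zero.mp h
    exact (smul_eq_zero.mp h2).resolve_left two_ne_zero
  leibniz_lie x y z := bracketLin_leibniz x y z

noncomputable instance : LieAlgebra ℂ PlanarGCA where
  lie_smul c x y := map_smul (bracketLin x) c y

/-- The homogeneous component of degree `n`. -/
noncomputable def component (n : ℤ) : Submodule ℂ PlanarGCA :=
  Submodule.span ℂ {gen .L n, gen .H n, gen .I n, gen .J n}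

/-- A module is restricted if every vector is killed by all components of large degree. -/
def IsRestricted (V : Type*) [AddCommGroup V] [Module ℂ V] [LieRingModule PlanarGCA V] : Prop :=
  ∀ v : V, ∃ i : ℕ, ∀ n : ℤ, (i : ℤ) ≤ n → ∀ x ∈ component n, ⁅x, v⁆ = 0

section OfGenerators

variable {M : Type*} [AddCommGroup M] [Module ℂ M]

/-- The linear extension of an assignment of operators to the basis vectors. -/
noncomputable def actionLin (ρ : Gen → ℤ → Module.End ℂ M) : PlanarGCA →ₗ[ℂ] Module.End ℂ M :=
  basis.constr ℂ fun a => ρ a.1 a.2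

theorem actionLin_gen (ρ : Gen → ℤ → Module.End ℂ M) (X : Gen) (n : ℤ) :
    actionLin ρ (gen X n) = ρ X n := by
  simp [actionLin, gen, Module.Basis.constr_basis]

theorem actionLin_bracket (ρ : Gen → ℤ → Module.End ℂ M)
    (hρ : ∀ X Y m n, actionLin ρ (bracketGen (X, m) (Y, n)) = ρ X m * ρ Y n - ρ Y n * ρ X m)
    (x y : PlanarGCA) :
    actionLin ρ ⁅x, y⁆ = actionLin ρ x * actionLin ρ y - actionLin ρ y * actionLin ρ x := by
  have h : bracketLin.compr₂ (actionLin ρ) =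
      (LinearMap.mul ℂ (Module.End ℂ M)).compl₁₂ (actionLin ρ) (actionLin ρ) -
        ((LinearMap.mul ℂ (Module.End ℂ M)).compl₁₂ (actionLin ρ) (actionLin ρ)).flip := by
    refine basis.ext fun a => basis.ext fun b => ?_
    change actionLin ρ (bracketLin (gen a.1 a.2) (gen b.1 b.2)) =
      actionLin ρ (gen a.1 a.2) * actionLin ρ (gen b.1 b.2) -
        actionLin ρ (gen b.1 b.2) * actionLin ρ (gen a.1 a.2)
    rw [bracketLin_gen, hρ, actionLin_gen, actionLin_gen]
  exact congrArg (fun f : PlanarGCA →ₗ[ℂ] PlanarGCA →ₗ[ℂ] Module.End ℂ M => f x y) h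

/-- The module structure in which `gen X n` acts by `ρ X n`. -/
@[reducible] noncomputable def lieRingModuleOfGen (ρ : Gen → ℤ → Module.End ℂ M)
    (hρ : ∀ X Y m n, actionLin ρ (bracketGen (X, m) (Y, n)) = ρ X m * ρ Y n - ρ Y n * ρ X m) :
    LieRingModule PlanarGCA M where
  bracket x v := actionLin ρ x v
  add_lie x y v := by
    change actionLin ρ (x + y) v = _
    rw [map_add]; rfl
  lie_add x v w := map_add (actionLin ρ x) v w
  leibniz_lie x y v := by
    change actionLin ρ x (actionLin ρ y v) =
      actionLin ρ ⁅x, y⁆ v + actionLin ρ y (actionLin ρ x v)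
    rw [actionLin_bracket ρ hρ]
    simp

end OfGenerators

/-- The substitution `f(X₀, X₁) ↦ f(X₀ - a, X₁ - b)` on `ℂ[X₀, X₁]`. -/
noncomputable def shift (a b : ℂ) : MvPolynomial (Fin 2) ℂ →ₐ[ℂ] MvPolynomial (Fin 2) ℂ :=
  MvPolynomial.aeval
    ![MvPolynomial.X 0 - MvPolynomial.C a, MvPolynomial.X 1 - MvPolynomial.C b]

theorem shift_X0 (a b : ℂ) :
    shift a b (MvPolynomial.X 0) = MvPolynomial.X 0 - MvPolynomial.C a := by simp [shift]

theorem shift_X1 (a b : ℂ) :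
    shift a b (MvPolynomial.X 1) = MvPolynomial.X 1 - MvPolynomial.C b := by simp [shift]

theorem shift_C (a b c : ℂ) :
    shift a b (MvPolynomial.C c) = MvPolynomial.C c := by simp [shift]

theorem shift_shift (a b c d : ℂ) (f : MvPolynomial (Fin 2) ℂ) :
    shift a b (shift c d f) = shift (a + c) (b + d) f := by
  have h : (shift a b).comp (shift c d) = shift (a + c) (b + d) := by
    refine MvPolynomial.algHom_ext fun i => ?_
    fin_cases i
    · simp only [Fin.zero_eta, AlgHom.comp_apply, shift_X0, map_sub, shift_C, map_add]
      ring
    · simp only [Fin.mk_one, AlgHom.comp_apply, shift_X1, map_sub, shift_C, map_add]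
      ring
  exact congrArg (fun φ : MvPolynomial (Fin 2) ℂ →ₐ[ℂ] MvPolynomial (Fin 2) ℂ => φ f) h

/-- The operator `f(X₀, X₁) ↦ c * p * f(X₀ - a, X₁ - b)`. -/
noncomputable def shiftOp (c : ℂ) (p : MvPolynomial (Fin 2) ℂ) (a b : ℂ) :
    Module.End ℂ (MvPolynomial (Fin 2) ℂ) :=
  c • (LinearMap.mulLeft ℂ p ∘ₗ (shift a b).toLinearMap)

theorem shiftOp_apply (c : ℂ) (p : MvPolynomial (Fin 2) ℂ) (a b : ℂ)
    (f : MvPolynomial (Fin 2) ℂ) :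
    shiftOp c p a b f = MvPolynomial.C c * (p * shift a b f) := by
  simp [shiftOp, MvPolynomial.smul_eq_C_mul]

/-- The operators of the module `Ω(lam, sig, eta) = ℂ[s, t]`, with `s = X 0` and `t = X 1`:
`L_n f = lam ^ n (s - n t + n eta) f(s - n, t)`, `H_n f = lam ^ n t f(s - n, t)`,
`I_n f = lam ^ n sig f(s - n, t - 1)`, `J_n f = 0`. -/
noncomputable def omegaAct (lam sig : ℂˣ) (eta : ℂ) :
    Gen → ℤ → Module.End ℂ (MvPolynomial (Fin 2) ℂ)
  | .L, n => shiftOp ((lam ^ n : ℂˣ) : ℂ)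
      (MvPolynomial.X 0 - MvPolynomial.C (n : ℂ) * MvPolynomial.X 1 +
        MvPolynomial.C ((n : ℂ) * eta)) n 0
  | .H, n => shiftOp ((lam ^ n : ℂˣ) : ℂ) (MvPolynomial.X 1) n 0
  | .I, n => shiftOp ((lam ^ n : ℂˣ) : ℂ) (MvPolynomial.C (sig : ℂ)) n 1
  | .J, _ => 0

/-- The operators of the module `Γ(lam, sig, eta) = ℂ[x, y]`, with `x = X 0` and `y = X 1`:
`L_n g = lam ^ n (x + n y + n eta) g(x - n, y)`, `H_n g = lam ^ n y g(x - n, y)`,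
`I_n g = 0`, `J_n g = lam ^ n sig g(x - n, y + 1)`. -/
noncomputable def gammaAct (lam sig : ℂˣ) (eta : ℂ) :
    Gen → ℤ → Module.End ℂ (MvPolynomial (Fin 2) ℂ)
  | .L, n => shiftOp ((lam ^ n : ℂˣ) : ℂ)
      (MvPolynomial.X 0 + MvPolynomial.C (n : ℂ) * MvPolynomial.X 1 +
        MvPolynomial.C ((n : ℂ) * eta)) n 0
  | .H, n => shiftOp ((lam ^ n : ℂˣ) : ℂ) (MvPolynomial.X 1) n 0
  | .I, _ => 0
  | .J, n => shiftOp ((lam ^ n : ℂˣ) : ℂ) (MvPolynomial.C (sig : ℂ)) n (-1)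

theorem omegaAct_bracket (lam sig : ℂˣ) (eta : ℂ) (X Y : Gen) (m n : ℤ) :
    actionLin (omegaAct lam sig eta) (bracketGen (X, m) (Y, n)) =
      omegaAct lam sig eta X m * omegaAct lam sig eta Y n -
        omegaAct lam sig eta Y n * omegaAct lam sig eta X m := by
  refine LinearMap.ext fun f => ?_
  cases X <;> cases Y <;>
    simp only [bracketGen, map_smul, map_neg, map_zero, actionLin_gen, omegaAct,
      LinearMap.smul_apply, LinearMap.neg_apply, LinearMap.zero_apply, LinearMap.sub_apply,
      Module.End.mul_apply, shiftOp_apply, map_mul, map_add, map_sub, shift_X0, shift_X1, shift_C,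
      shift_shift, MvPolynomial.smul_eq_C_mul, zpow_add, Units.val_mul, Int.cast_add,
      add_zero, zero_add, mul_zero, sub_zero, sub_self, neg_zero, add_comm (n : ℂ) (m : ℂ),
      map_one, smul_zero] <;>
    ring

theorem gammaAct_bracket (lam sig : ℂˣ) (eta : ℂ) (X Y : Gen) (m n : ℤ) :
    actionLin (gammaAct lam sig eta) (bracketGen (X, m) (Y, n)) =
      gammaAct lam sig eta X m * gammaAct lam sig eta Y n -
        gammaAct lam sig eta Y n * gammaAct lam sig eta X m := by
  refine LinearMap.ext fun f => ?_
  cases X <;> cases Y <;>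
    simp only [bracketGen, map_smul, map_neg, map_zero, actionLin_gen, gammaAct,
      LinearMap.smul_apply, LinearMap.neg_apply, LinearMap.zero_apply, LinearMap.sub_apply,
      Module.End.mul_apply, shiftOp_apply, map_mul, map_add, map_sub, shift_X0, shift_X1, shift_C,
      shift_shift, MvPolynomial.smul_eq_C_mul, zpow_add, Units.val_mul, Int.cast_add,
      add_zero, zero_add, mul_zero, sub_zero, sub_self, neg_zero, add_comm (n : ℂ) (m : ℂ),
      map_one, smul_zero] <;>
    ring

/-- The underlying space `ℂ[s, t]` of the module `Ω(lam, sig, eta)`. -/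
@[nolint unusedArguments]
def Omega (_lam _sig : ℂˣ) (_eta : ℂ) : Type := MvPolynomial (Fin 2) ℂ

/-- The underlying space `ℂ[x, y]` of the module `Γ(lam, sig, eta)`. -/
@[nolint unusedArguments]
def Gamma (_lam _sig : ℂˣ) (_eta : ℂ) : Type := MvPolynomial (Fin 2) ℂ

section Instances

variable (lam sig : ℂˣ) (eta : ℂ)

noncomputable instance : AddCommGroup (Omega lam sig eta) :=
  inferInstanceAs (AddCommGroup (MvPolynomial (Fin 2) ℂ))

noncomputable instance : Module ℂ (Omega lam sig eta) :=
  inferInstanceAs (Module ℂ (MvPolynomial (Fin 2) ℂ))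

noncomputable instance : LieRingModule PlanarGCA (Omega lam sig eta) :=
  lieRingModuleOfGen (M := MvPolynomial (Fin 2) ℂ) (omegaAct lam sig eta)
    (omegaAct_bracket lam sig eta)

noncomputable instance : LieModule ℂ PlanarGCA (Omega lam sig eta) where
  smul_lie c x v := by
    change actionLin (omegaAct lam sig eta) (c • x) v = _
    rw [map_smul]; rfl
  lie_smul c x v := map_smul (actionLin (omegaAct lam sig eta) x) c v

noncomputable instance : AddCommGroup (Gamma lam sig eta) :=
  inferInstanceAs (AddCommGroup (MvPolynomial (Fin 2) ℂ))

noncomputable instance : Module ℂ (Gamma lam sig eta) :=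
  inferInstanceAs (Module ℂ (MvPolynomial (Fin 2) ℂ))

noncomputable instance : LieRingModule PlanarGCA (Gamma lam sig eta) :=
  lieRingModuleOfGen (M := MvPolynomial (Fin 2) ℂ) (gammaAct lam sig eta)
    (gammaAct_bracket lam sig eta)

noncomputable instance : LieModule ℂ PlanarGCA (Gamma lam sig eta) where
  smul_lie c x v := by
    change actionLin (gammaAct lam sig eta) (c • x) v = _
    rw [map_smul]; rfl
  lie_smul c x v := map_smul (actionLin (gammaAct lam sig eta) x) c v

end Instances

section PiTensor

variable {n : ℕ} {M : Fin n → Type*} [∀ i, AddCommGroup (M i)] [∀ i, Module ℂ (M i)]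

/-- An endomorphism of the `i`-th factor, acting on the tensor product of all factors. -/
noncomputable def factorEnd (i : Fin n) (f : Module.End ℂ (M i)) :
    Module.End ℂ (⨂[ℂ] i, M i) :=
  PiTensorProduct.map (Function.update (fun j => (LinearMap.id : M j →ₗ[ℂ] M j)) i f)

theorem factorEnd_add (i : Fin n) (f g : Module.End ℂ (M i)) :
    factorEnd i (f + g) = factorEnd i f + factorEnd i g :=
  PiTensorProduct.map_update_add _ i f g

theorem factorEnd_smul (i : Fin n) (c : ℂ) (f : Module.End ℂ (M i)) :
    factorEnd i (c • f) = c • factorEnd i f :=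
  PiTensorProduct.map_update_smul _ i c f

theorem factorEnd_mul (i : Fin n) (f g : Module.End ℂ (M i)) :
    factorEnd i (f * g) = factorEnd i f * factorEnd i g := by
  have h := congrArg PiTensorProduct.mapMonoidHom
    (Pi.mulSingle_mul (f := fun j => Module.End ℂ (M j)) i f g)
  rw [map_mul] at h
  exact h

theorem factorEnd_commute {i j : Fin n} (hij : i ≠ j) (f : Module.End ℂ (M i))
    (g : Module.End ℂ (M j)) :
    factorEnd i f * factorEnd j g = factorEnd j g * factorEnd i f :=
  ((Pi.mulSingle_commute (f := fun j => Module.End ℂ (M j)) hij f g).map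
    PiTensorProduct.mapMonoidHom).eq

variable [∀ i, LieRingModule PlanarGCA (M i)] [∀ i, LieModule ℂ PlanarGCA (M i)]

/-- The action on a tensor product of finitely many modules:
`x (m₁ ⊗ ⋯ ⊗ mₙ) = ∑ i, m₁ ⊗ ⋯ ⊗ (x mᵢ) ⊗ ⋯ ⊗ mₙ`. -/
noncomputable def piAct : PlanarGCA →ₗ[ℂ] Module.End ℂ (⨂[ℂ] i, M i) where
  toFun x := ∑ i, factorEnd i (LieModule.toEnd ℂ PlanarGCA (M i) x)
  map_add' x y := by simp [factorEnd_add, Finset.sum_add_distrib]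
  map_smul' c x := by simp [factorEnd_smul, Finset.smul_sum]

theorem piAct_tprod (x : PlanarGCA) (v : ∀ i, M i) :
    piAct x (PiTensorProduct.tprod ℂ v) =
      ∑ i, PiTensorProduct.tprod ℂ (Function.update v i ⁅x, v i⁆) := by
  simp only [piAct, LinearMap.coe_mk, AddHom.coe_mk, LinearMap.sum_apply, factorEnd,
    PiTensorProduct.map_tprod]
  refine Finset.sum_congr rfl fun i _ => congrArg _ (funext fun j => ?_)
  by_cases h : j = i
  · subst h; simp
  · simp [h]

theorem piAct_bracket (x y : PlanarGCA) :
    piAct (M := M) ⁅x, y⁆ = piAct x * piAct y - piAct y * piAct x := by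
  simp only [piAct, LinearMap.coe_mk, AddHom.coe_mk, Finset.sum_mul_sum]
  rw [Finset.sum_comm (f := fun i j => factorEnd i (LieModule.toEnd ℂ PlanarGCA (M i) y) *
    factorEnd j (LieModule.toEnd ℂ PlanarGCA (M j) x)), ← Finset.sum_sub_distrib]
  refine Finset.sum_congr rfl fun i _ => ?_
  rw [← Finset.sum_sub_distrib, Finset.sum_eq_single i]
  · have h : LieModule.toEnd ℂ PlanarGCA (M i) ⁅x, y⁆ +
        LieModule.toEnd ℂ PlanarGCA (M i) y * LieModule.toEnd ℂ PlanarGCA (M i) x =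
        LieModule.toEnd ℂ PlanarGCA (M i) x * LieModule.toEnd ℂ PlanarGCA (M i) y := by
      ext v
      simp [Module.End.mul_apply]
    rw [← factorEnd_mul, ← factorEnd_mul, ← h, factorEnd_add, add_sub_cancel_right]
  · intro j _ hj
    rw [factorEnd_commute hj.symm, sub_self]
  · simp

noncomputable instance : LieRingModule PlanarGCA (⨂[ℂ] i, M i) where
  bracket x v := piAct x v
  add_lie x y v := by
    change piAct (x + y) v = _
    rw [map_add]; rfl
  lie_add x v w := map_add (piAct x) v w
  leibniz_lie x y v := by
    change piAct x (piAct y v) = piAct ⁅x, y⁆ v + piAct y (piAct x v)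
    rw [piAct_bracket]
    simp

noncomputable instance : LieModule ℂ PlanarGCA (⨂[ℂ] i, M i) where
  smul_lie c x v := by
    change piAct (c • x) v = _
    rw [map_smul]; rfl
  lie_smul c x v := map_smul (piAct x) c v

end PiTensor

/-- The tensor product of `m₁` modules `Ω(λ_k, σ_k, η_k)`, of `m₂` modules `Γ(λ_k, σ_k, η_k)` and of
`V`. The parameters with the first `m₁` indices belong to the modules `Ω`, the others to `Γ`. -/
abbrev TensorModule (m₁ m₂ : ℕ) (lam sig : Fin (m₁ + m₂) → ℂˣ) (eta : Fin (m₁ + m₂) → ℂ)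
    (V : Type*) [AddCommGroup V] [Module ℂ V] : Type _ :=
  ((⨂[ℂ] k : Fin m₁, Omega (lam (Fin.castAdd m₂ k)) (sig (Fin.castAdd m₂ k))
      (eta (Fin.castAdd m₂ k))) ⊗[ℂ]
    (⨂[ℂ] k : Fin m₂, Gamma (lam (Fin.natAdd m₁ k)) (sig (Fin.natAdd m₁ k))
      (eta (Fin.natAdd m₁ k)))) ⊗[ℂ] V

end PlanarGCA

/-! Sufficiency. Let `W` be a nonzero submodule and `w ∈ W`. A basis vector of degree `n` acts on
`w` by a sum of one term per tensor factor. The term of the `k`-th polynomial factor is `λ_k ^ n`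
times a polynomial in `n`. The term of `V` vanishes for large `n`, because `V` is restricted. Modulo
`W` the sum is zero for every `n`. As functions of `n` the terms are generalized eigenvectors of the
shift of sequences, with eigenvalues `λ_k` and `0`. These are pairwise distinct, so each polynomial
factor's term lies in `W` (`eq_zero_of_sum_isExpPoly`, `factor_gen_mem_stabilizer`).

On one polynomial factor, `L_0` and `H_0` are multiplications by the variables, and `I_n` or `J_n`
is a nonzero multiple of a translation. By the Nullstellensatz these operators act irreducibly, with
scalar commutant, so Jacobson density (`exists_mem_eqOn`) makes `W` stable under all endomorphisms
of each polynomial factor. By subtraction `W` is also stable under the action on `V` alone. Matrix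
units then extract coefficients in `V`, and simplicity of `V` gives `W = ⊤`
(`eq_top_of_mem_stabilizer`).

Necessity. If two factors share the parameter `λ`, let `τ_a`, `τ'_a` translate their first variables
by `a ∈ ℤ`. Both satisfy `τ_a L_n = L_n τ_a - a λ ^ n τ_{a+n}` and commute with the other
generators. Hence the common kernel of all `τ_a - τ'_a`, the polynomials depending on the two
variables only through their sum, is a submodule. It contains the constants tensored with `V`, and
it is proper because multiplication by just one of the two variables leaves it
(`not_isIrreducible_of_isShiftFamily`). -/

set_option maxSynthPendingDepth 3

namespace PlanarGCA

/-! ### Exponential polynomials as generalized eigenvectors of the shift -/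

section Sequences

variable {T T' : Type*} [AddCommGroup T] [Module ℂ T] [AddCommGroup T'] [Module ℂ T']

/-- The shift operator on sequences. -/
noncomputable def seqShift (T : Type*) [AddCommGroup T] [Module ℂ T] : Module.End ℂ (ℕ → T) :=
  LinearMap.funLeft ℂ T Nat.succ

theorem seqShift_apply (u : ℕ → T) (n : ℕ) : seqShift T u n = u (n + 1) := rfl

/-- A sequence of the form `n ↦ μ ^ n • p n` with `p` polynomial, that is, one of which each
restriction to a half-line is a generalized eigenvector of the shift operator. -/
def IsExpPoly (μ : ℂ) (u : ℤ → T) : Prop :=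
  ∀ a : ℤ, (fun n : ℕ => u (a + n)) ∈ (seqShift T).maxGenEigenspace μ

/-- The shift commutes with applying a linear map termwise, so the same exponent works. -/
theorem maxGenEigenspace_seqShift_comp (ℓ : T →ₗ[ℂ] T') {μ : ℂ} {u : ℕ → T}
    (hu : u ∈ (seqShift T).maxGenEigenspace μ) :
    (fun n => ℓ (u n)) ∈ (seqShift T').maxGenEigenspace μ := by
  rw [Module.End.mem_maxGenEigenspace] at hu ⊢
  obtain ⟨k, hk⟩ := hu
  refine ⟨k, ?_⟩
  induction k generalizing u with
  | zero =>
    have : u = 0 := by simpa using hk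
    subst this
    funext n
    simp
  | succ k ih =>
    rw [pow_succ, Module.End.mul_apply] at hk ⊢
    rw [← ih hk]
    congr 1
    funext n
    simp [seqShift_apply]

/-- With `S` the shift, `(S - μ)(n u_n) = n ((S - μ) u)_n + (S u)_n`, and `S` commutes with powers
of `S - μ`. A factor `n` therefore costs one more power. -/
theorem maxGenEigenspace_seqShift_natCast_smul {μ : ℂ} {u : ℕ → T}
    (hu : u ∈ (seqShift T).maxGenEigenspace μ) :
    (fun n : ℕ => (n : ℂ) • u n) ∈ (seqShift T).maxGenEigenspace μ := by
  rw [Module.End.mem_maxGenEigenspace] at hu ⊢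
  obtain ⟨k, hk⟩ := hu
  refine ⟨k + 1, ?_⟩
  induction k generalizing u with
  | zero =>
    have : u = 0 := by simpa using hk
    subst this
    simp only [Pi.zero_apply, smul_zero]
    exact map_zero _
  | succ k ih =>
    have key : (seqShift T - μ • (1 : Module.End ℂ (ℕ → T))) (fun n : ℕ => (n : ℂ) • u n) =
        (fun n : ℕ => (n : ℂ) • ((seqShift T - μ • (1 : Module.End ℂ (ℕ → T))) u n)) +
          seqShift T u := by
      funext n
      simp only [LinearMap.sub_apply, LinearMap.smul_apply, Module.End.one_apply, Pi.sub_apply,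
        Pi.add_apply, Pi.smul_apply, seqShift_apply, Nat.cast_add, Nat.cast_one]
      module
    have hcomm : Commute ((seqShift T - μ • (1 : Module.End ℂ (ℕ → T))) ^ (k + 1))
        (seqShift T) :=
      (((Commute.refl _).sub_left ((Commute.one_left _).smul_left μ))).pow_left _
    rw [pow_succ, Module.End.mul_apply, key, map_add, ← Module.End.mul_apply _ (seqShift T),
      hcomm.eq, Module.End.mul_apply (seqShift T), hk, map_zero, add_zero]
    refine ih ?_
    rwa [pow_succ, Module.End.mul_apply] at hk

namespace IsExpPoly

variable {μ : ℂ} {u v : ℤ → T}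

theorem zero : IsExpPoly μ (fun _ => (0 : T)) := fun _ => Submodule.zero_mem _

theorem add (hu : IsExpPoly μ u) (hv : IsExpPoly μ v) : IsExpPoly μ fun n => u n + v n :=
  fun a => Submodule.add_mem _ (hu a) (hv a)

theorem comp (ℓ : T →ₗ[ℂ] T') (hu : IsExpPoly μ u) : IsExpPoly μ fun n => ℓ (u n) :=
  fun a => maxGenEigenspace_seqShift_comp ℓ (hu a)

theorem smul (c : ℂ) (hu : IsExpPoly μ u) : IsExpPoly μ fun n => c • u n :=
  hu.comp (c • LinearMap.id)

theorem intCast_smul (hu : IsExpPoly μ u) : IsExpPoly μ fun n => (n : ℂ) • u n := by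
  intro a
  have h := Submodule.add_mem _ (Submodule.smul_mem _ (a : ℂ) (hu a))
    (maxGenEigenspace_seqShift_natCast_smul (hu a))
  convert h using 1
  funext n
  simp [add_smul]

theorem zpow_smul (μ : ℂˣ) (x : T) : IsExpPoly (μ : ℂ) fun n => ((μ ^ n : ℂˣ) : ℂ) • x := by
  intro a
  rw [Module.End.mem_maxGenEigenspace]
  refine ⟨1, ?_⟩
  funext n
  simp only [pow_one, LinearMap.sub_apply, LinearMap.smul_apply, Module.End.one_apply,
    Pi.sub_apply, Pi.smul_apply, seqShift_apply, smul_smul, Pi.zero_apply, ← sub_smul]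
  rw [← Units.val_mul, ← zpow_one_add]
  rw [show 1 + (a + (n : ℤ)) = a + ((n + 1 : ℕ) : ℤ) by push_cast; ring, sub_self, zero_smul]

end IsExpPoly

/-- Exponential polynomials with distinct nonzero bases and a sequence which vanishes far out are
linearly independent. -/
theorem eq_zero_of_sum_isExpPoly {ι : Type*} [Fintype ι] {μ : ι → ℂˣ}
    (hμ : Function.Injective μ) {u : ι → ℤ → T} (hu : ∀ i, IsExpPoly (μ i : ℂ) (u i))
    {z : ℤ → T} (hz : ∃ N : ℤ, ∀ n, N ≤ n → z n = 0) (hsum : ∀ n, ∑ i, u i n + z n = 0)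
    (i : ι) (n : ℤ) : u i n = 0 := by
  -- On sequences indexed by `ℕ` the shift is not injective, and a sequence vanishing far out is
  -- killed by a power of it. This would fail on `ℤ`, hence the half-lines.
  have hz' : (fun k : ℕ => z (n + k)) ∈ (seqShift T).maxGenEigenspace 0 := by
    obtain ⟨N, hN⟩ := hz
    rw [Module.End.mem_maxGenEigenspace]
    refine ⟨(N - n).toNat, ?_⟩
    have : ∀ (d : ℕ) (w : ℕ → T) (k : ℕ), ((seqShift T) ^ d) w k = w (k + d) := by
      intro d
      induction d with
      | zero => intro w k; rfl
      | succ d ih =>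
        intro w k
        rw [pow_succ, Module.End.mul_apply, ih, seqShift_apply]
        rfl
    funext k
    rw [zero_smul, sub_zero, this]
    refine hN _ ?_
    push_cast
    have := Int.self_le_toNat (N - n)
    omega
  -- The index `none` carries the eigenvalue `0` of the remainder `z`; it differs from every `μ i`
  -- because these are units.
  have hind := (seqShift T).independent_maxGenEigenspace.comp
    (f := fun j : Option ι => j.elim (0 : ℂ) fun i => (μ i : ℂ)) (by
      rintro (_ | i) (_ | j) h
      · rfl
      · exact absurd h.symm (μ j).ne_zero
      · exact absurd h (μ i).ne_zero
      · exact congrArg some (hμ (Units.ext h)))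
  rw [iSupIndep_iff_finsetSum_eq_zero_imp_eq_zero] at hind
  have h := hind Finset.univ
    (fun j => j.elim (fun k : ℕ => z (n + k)) fun i => fun k : ℕ => u i (n + k))
    (by
      rintro (_ | i) -
      · exact hz'
      · exact hu i n)
    (by
      rw [Fintype.sum_option]
      funext k
      simpa [add_comm] using hsum (n + k))
    (some i) (Finset.mem_univ _)
  simpa using congrFun h 0

end Sequences

/-! ### Translations of polynomials in two variables -/

section Polynomials

open MvPolynomial

/-- Induction on `f`: a factor `X 0` becomes `X 0 - n`, which raises the degree in `n` by at most
one, and a factor `X 1` becomes `X 1 - b`, independent of `n`. -/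
theorem isExpPoly_shift (lam : ℂˣ) (b : ℂ) (f : MvPolynomial (Fin 2) ℂ) :
    IsExpPoly (lam : ℂ) fun n => ((lam ^ n : ℂˣ) : ℂ) • shift n b f := by
  induction f using MvPolynomial.induction_on with
  | C c => simpa only [shift_C] using IsExpPoly.zpow_smul lam (C c)
  | add p q hp hq => simpa only [map_add, smul_add] using hp.add hq
  | mul_X p i hp =>
    fin_cases i
    · have h := (hp.comp (LinearMap.mulLeft ℂ (X 0))).add (hp.intCast_smul.smul (-1))
      convert h using 2 with n
      simp only [Fin.zero_eta, map_mul, shift_X0, LinearMap.mulLeft_apply, smul_eq_C_mul, map_neg,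
        map_one]
      ring
    · have h := (hp.comp (LinearMap.mulLeft ℂ (X 1))).add (hp.smul (-b))
      convert h using 2 with n
      simp only [Fin.mk_one, map_mul, shift_X1, LinearMap.mulLeft_apply, smul_eq_C_mul, map_neg]
      ring

theorem isExpPoly_omegaAct (lam sig : ℂˣ) (eta : ℂ) (Y : Gen) (f : MvPolynomial (Fin 2) ℂ) :
    IsExpPoly (lam : ℂ) fun n => omegaAct lam sig eta Y n f := by
  have h0 := isExpPoly_shift lam 0 f
  cases Y
  · have h := (h0.comp (LinearMap.mulLeft ℂ (X 0))).add
      (h0.intCast_smul.comp (LinearMap.mulLeft ℂ (C eta - X 1)))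
    convert h using 2 with n
    simp only [omegaAct, shiftOp_apply, LinearMap.mulLeft_apply, smul_eq_C_mul, map_mul]
    ring
  · convert h0.comp (LinearMap.mulLeft ℂ (X 1)) using 2 with n
    simp only [omegaAct, shiftOp_apply, LinearMap.mulLeft_apply, smul_eq_C_mul]
    ring
  · convert (isExpPoly_shift lam 1 f).comp (LinearMap.mulLeft ℂ (C (sig : ℂ))) using 2 with n
    simp only [omegaAct, shiftOp_apply, LinearMap.mulLeft_apply, smul_eq_C_mul]
    ring
  · exact IsExpPoly.zero

theorem isExpPoly_gammaAct (lam sig : ℂˣ) (eta : ℂ) (Y : Gen) (f : MvPolynomial (Fin 2) ℂ) :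
    IsExpPoly (lam : ℂ) fun n => gammaAct lam sig eta Y n f := by
  have h0 := isExpPoly_shift lam 0 f
  cases Y
  · have h := (h0.comp (LinearMap.mulLeft ℂ (X 0))).add
      (h0.intCast_smul.comp (LinearMap.mulLeft ℂ (C eta + X 1)))
    convert h using 2 with n
    simp only [gammaAct, shiftOp_apply, LinearMap.mulLeft_apply, smul_eq_C_mul, map_mul]
    ring
  · convert h0.comp (LinearMap.mulLeft ℂ (X 1)) using 2 with n
    simp only [gammaAct, shiftOp_apply, LinearMap.mulLeft_apply, smul_eq_C_mul]
    ring
  · exact IsExpPoly.zero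
  · convert (isExpPoly_shift lam (-1) f).comp (LinearMap.mulLeft ℂ (C (sig : ℂ))) using 2 with n
    simp only [gammaAct, shiftOp_apply, LinearMap.mulLeft_apply, smul_eq_C_mul]
    ring

theorem eval_shift (a b : ℂ) (x : Fin 2 → ℂ) (f : MvPolynomial (Fin 2) ℂ) :
    eval x (shift a b f) = eval ![x 0 - a, x 1 - b] f := by
  induction f using MvPolynomial.induction_on with
  | C c => simp
  | add p q hp hq => simp [hp, hq]
  | mul_X p i hp =>
    fin_cases i
    · simp [hp, shift_X0]
    · simp [hp, shift_X1]

/-- A polynomial is determined by its values on a translate of `ℤ × ℕ`. -/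
theorem eq_of_eval_lattice {ε : ℂ} (hε : ε ≠ 0) (x : Fin 2 → ℂ) {p q : MvPolynomial (Fin 2) ℂ}
    (h : ∀ (n : ℤ) (k : ℕ), eval ![x 0 - n, x 1 - (k + 1) * ε] p =
      eval ![x 0 - n, x 1 - (k + 1) * ε] q) : p = q := by
  refine funext_set
    ![Set.range fun n : ℤ => x 0 - n, Set.range fun k : ℕ => x 1 - (k + 1) * ε] ?_ ?_
  · intro i
    fin_cases i
    · refine Set.infinite_range_of_injective fun a b hab => ?_
      simpa using hab
    · refine Set.infinite_range_of_injective fun a b hab => ?_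
      simpa [hε] using hab
  · intro y hy
    obtain ⟨n, hn⟩ : y 0 ∈ Set.range fun n : ℤ => x 0 - n := hy 0 (Set.mem_univ _)
    obtain ⟨k, hk⟩ : y 1 ∈ Set.range fun k : ℕ => x 1 - (k + 1) * ε := hy 1 (Set.mem_univ _)
    have hy' : y = ![x 0 - n, x 1 - (k + 1) * ε] := by
      funext i
      fin_cases i
      · exact hn.symm
      · exact hk.symm
    rw [hy']
    exact h n k

theorem shift_zero : shift 0 0 = AlgHom.id ℂ _ := by
  refine MvPolynomial.algHom_ext fun i => ?_
  fin_cases i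
  · simp [shift_X0]
  · simp [shift_X1]

/-- The algebras considered below are only assumed to contain translations whose second step is
exactly `ε`. Their composites reach the steps `(k + 1) * ε`, never a step `0`, which is why the
lattice starts at `ε`. -/
theorem shift_eq_iterate (ε : ℂ) (n : ℤ) (k : ℕ) (f : MvPolynomial (Fin 2) ℂ) :
    shift n ((k + 1) * ε) f = shift n ε ((shift 0 ε)^[k] f) := by
  have h : (shift 0 ε)^[k] f = shift 0 (k * ε) f := by
    induction k with
    | zero => simp [shift_zero]
    | succ k ih =>
      rw [Function.iterate_succ_apply', ih, shift_shift]
      congr 2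
      · simp
      · push_cast; ring
  rw [h, shift_shift]
  congr 2
  · simp
  · ring

/-! ### Density of the algebra of multiplications and translations -/

section Density

variable {R : Subalgebra ℂ (Module.End ℂ (MvPolynomial (Fin 2) ℂ))} {ε : ℂ}

theorem mulLeft_mem_of_X_mem (h0 : LinearMap.mulLeft ℂ (X 0) ∈ R)
    (h1 : LinearMap.mulLeft ℂ (X 1) ∈ R) (p : MvPolynomial (Fin 2) ℂ) :
    LinearMap.mulLeft ℂ p ∈ R := by
  induction p using MvPolynomial.induction_on with
  | C c =>
    convert R.algebraMap_mem c using 1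
    refine LinearMap.ext fun f => ?_
    simp [Module.algebraMap_end_apply, smul_eq_C_mul]
  | add p q hp hq =>
    convert R.add_mem hp hq using 1
    refine LinearMap.ext fun f => ?_
    simp [add_mul]
  | mul_X p i hp =>
    have hi : LinearMap.mulLeft ℂ (X i) ∈ R := by fin_cases i <;> assumption
    rw [LinearMap.mulLeft_mul]
    exact R.mul_mem hp hi

/-- A proper submodule is a proper ideal, so by the Nullstellensatz it vanishes at some point `x`.
It is stable under translations, so each of its elements vanishes on a Zariski dense translate of a
lattice and is zero. -/
theorem isSimpleModule_of_mem (hε : ε ≠ 0) (h0 : LinearMap.mulLeft ℂ (X 0) ∈ R)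
    (h1 : LinearMap.mulLeft ℂ (X 1) ∈ R) (hs : ∀ n : ℤ, (shift n ε).toLinearMap ∈ R) :
    IsSimpleModule R (MvPolynomial (Fin 2) ℂ) := by
  have hmul := mulLeft_mem_of_X_mem h0 h1
  rw [isSimpleModule_iff]
  refine IsSimpleOrder.of_forall_eq_top fun N hN => ?_
  let A : Ideal (MvPolynomial (Fin 2) ℂ) :=
    { carrier := N
      add_mem' := N.add_mem
      zero_mem' := N.zero_mem
      smul_mem' := fun c x hx => N.smul_mem (⟨_, hmul c⟩ : R) hx }
  have hshift : ∀ (n : ℤ) f, f ∈ N → shift n ε f ∈ N := fun n f hf =>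
    N.smul_mem (⟨_, hs n⟩ : R) hf
  have hiter : ∀ (k : ℕ) f, f ∈ N → (shift 0 ε)^[k] f ∈ N := by
    intro k f hf
    induction k with
    | zero => exact hf
    | succ k ih =>
      rw [Function.iterate_succ_apply']
      simpa using hshift 0 _ ih
  by_contra hNtop
  have hA : A ≠ ⊤ := by
    intro h
    exact hNtop (eq_top_iff.2 fun x _ => (h ▸ Submodule.mem_top : x ∈ A))
  obtain ⟨m, hm, hAm⟩ := Ideal.exists_le_maximal A hA
  obtain ⟨x, hx⟩ := isMaximal_iff_eq_vanishingIdeal_singleton.1 hm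
  obtain ⟨f, hf, hf0⟩ := (Submodule.ne_bot_iff N).1 hN
  refine hf0 (eq_of_eval_lattice hε x fun n k => ?_)
  have hmem : shift n ((k + 1) * ε) f ∈ m := by
    rw [shift_eq_iterate]
    exact hAm (hshift n _ (hiter k f hf))
  rw [hx, mem_vanishingIdeal_singleton_iff] at hmem
  rw [map_zero, ← eval_shift]
  simpa [aeval_eq_eval] using hmem

/-- Commuting with multiplications forces `φ f = f * φ 1`. Commuting with translations makes `φ 1`
translation invariant, hence constant. -/
theorem exists_end_eq_C_mul (hε : ε ≠ 0) (h0 : LinearMap.mulLeft ℂ (X 0) ∈ R)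
    (h1 : LinearMap.mulLeft ℂ (X 1) ∈ R) (hs : ∀ n : ℤ, (shift n ε).toLinearMap ∈ R)
    (φ : Module.End R (MvPolynomial (Fin 2) ℂ)) : ∃ c : ℂ, ∀ f, φ f = c • f := by
  have hmul : ∀ f, φ f = f * φ 1 := fun f => by
    have h := φ.map_smul (⟨_, mulLeft_mem_of_X_mem h0 h1 f⟩ : R) 1
    have h' : φ (f * 1) = f * φ 1 := h
    rwa [mul_one] at h'
  have hshift : ∀ n : ℤ, shift n ε (φ 1) = φ 1 := fun n => by
    have h := φ.map_smul (⟨_, hs n⟩ : R) 1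
    have h' : φ (shift n ε 1) = shift n ε (φ 1) := h
    rw [map_one] at h'
    exact h'.symm
  have hiter : ∀ k : ℕ, (shift 0 ε)^[k] (φ 1) = φ 1 := fun k =>
    Function.iterate_fixed (by simpa using hshift 0) k
  refine ⟨eval 0 (φ 1), fun f => ?_⟩
  have : φ 1 = C (eval 0 (φ 1)) := by
    refine eq_of_eval_lattice hε 0 fun n k => ?_
    rw [← eval_shift, shift_eq_iterate, hiter, hshift, eval_C]
  rw [hmul, smul_eq_C_mul, ← this, mul_comm]

/-- Jacobson density for the algebra generated by multiplications and shifts. -/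
theorem exists_mem_eqOn (hε : ε ≠ 0) (h0 : LinearMap.mulLeft ℂ (X 0) ∈ R)
    (h1 : LinearMap.mulLeft ℂ (X 1) ∈ R) (hs : ∀ n : ℤ, (shift n ε).toLinearMap ∈ R)
    (g : Module.End ℂ (MvPolynomial (Fin 2) ℂ)) (s : Finset (MvPolynomial (Fin 2) ℂ)) :
    ∃ r ∈ R, ∀ f ∈ s, r f = g f := by
  have := isSimpleModule_of_mem hε h0 h1 hs
  -- Since the commutant consists of scalars, every `ℂ`-linear map is linear over it, so the density
  -- theorem applies to `g`.
  let g' : Module.End (Module.End R (MvPolynomial (Fin 2) ℂ)) (MvPolynomial (Fin 2) ℂ) :=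
    { toFun := g
      map_add' := g.map_add
      map_smul' := fun φ f => by
        obtain ⟨c, hc⟩ := exists_end_eq_C_mul hε h0 h1 hs φ
        simp [Module.End.smul_def, hc] }
  obtain ⟨r, hr⟩ := jacobson_density (R := R) (M := MvPolynomial (Fin 2) ℂ) g' s
  exact ⟨r, r.2, fun f hf => (hr f hf).symm⟩

end Density

end Polynomials

/-! ### Operators acting on one tensor factor -/

section TensorFactors

variable {M T : Type*} [AddCommGroup M] [Module ℂ M] [AddCommMonoid T] [Module ℂ T]

/-- The algebra of endomorphisms under which a submodule is stable. -/
def stabilizer (W : Submodule ℂ T) : Subalgebra ℂ (Module.End ℂ T) where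
  carrier := {f | ∀ w ∈ W, f w ∈ W}
  mul_mem' hf hg w hw := hf _ (hg w hw)
  add_mem' hf hg w hw := W.add_mem (hf w hw) (hg w hw)
  algebraMap_mem' c w hw := by
    rw [Module.algebraMap_end_apply]
    exact W.smul_mem c hw

/-- An action of the endomorphisms of `M` on `T` that looks like the one on `M ⊗ T'`: on suitable
vectors spanning `T`, it is given by the action on an element of `M`. -/
def IsTensorFactor (Φ : Module.End ℂ M →ₐ[ℂ] Module.End ℂ T) : Prop :=
  ∀ w : T, w ∈ Submodule.span ℂ {t : T | ∃ (m : M) (ℓ : M →ₗ[ℂ] T), ∀ g, Φ g t = ℓ (g m)}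

namespace IsTensorFactor

variable {Φ : Module.End ℂ M →ₐ[ℂ] Module.End ℂ T}

theorem isExpPoly (hΦ : IsTensorFactor Φ) {T' : Type*} [AddCommGroup T'] [Module ℂ T']
    (ℓ' : T →ₗ[ℂ] T') {μ : ℂ} {ρ : ℤ → Module.End ℂ M} (hρ : ∀ m, IsExpPoly μ fun n => ρ n m)
    (w : T) : IsExpPoly μ fun n => ℓ' (Φ (ρ n) w) := by
  induction hΦ w using Submodule.span_induction with
  | mem t ht =>
    obtain ⟨m, ℓ, h⟩ := ht
    simpa only [h, LinearMap.comp_apply] using (hρ m).comp (ℓ' ∘ₗ ℓ)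
  | zero => simpa only [map_zero] using IsExpPoly.zero
  | add x y _ _ hx hy => simpa only [map_add] using hx.add hy
  | smul c x _ hx => simpa only [map_smul] using hx.smul c

/-- A tensor involves only finitely many vectors of the factor `M`; this is what lets density on
finite sets suffice. -/
theorem exists_finset (hΦ : IsTensorFactor Φ) (w : T) :
    ∃ s : Finset M, ∀ g g' : Module.End ℂ M, (∀ m ∈ s, g m = g' m) → Φ g w = Φ g' w := by
  classical
  induction hΦ w using Submodule.span_induction with
  | mem t ht =>
    obtain ⟨m, ℓ, h⟩ := ht
    exact ⟨{m}, fun g g' hg => by rw [h, h, hg m (Finset.mem_singleton_self m)]⟩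
  | zero => exact ⟨∅, fun g g' _ => by simp⟩
  | add x y _ _ hx hy =>
    obtain ⟨s, hs⟩ := hx
    obtain ⟨s', hs'⟩ := hy
    refine ⟨s ∪ s', fun g g' hg => ?_⟩
    rw [map_add, map_add, hs g g' fun m hm => hg m (Finset.mem_union_left _ hm),
      hs' g g' fun m hm => hg m (Finset.mem_union_right _ hm)]
  | smul c x _ hx =>
    obtain ⟨s, hs⟩ := hx
    exact ⟨s, fun g g' hg => by rw [map_smul, map_smul, hs g g' hg]⟩

theorem mem_stabilizer_of_dense (hΦ : IsTensorFactor Φ) (W : Submodule ℂ T)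
    (h : ∀ (g : Module.End ℂ M) (s : Finset M), ∃ r ∈ (stabilizer W).comap Φ, ∀ m ∈ s, r m = g m)
    (g : Module.End ℂ M) : Φ g ∈ stabilizer W := by
  intro w hw
  obtain ⟨s, hs⟩ := hΦ.exists_finset w
  obtain ⟨r, hr, hrg⟩ := h g s
  rw [← hs r g hrg]
  exact hr w hw

theorem rTensor (hΦ : IsTensorFactor Φ) (Q : Type*) [AddCommMonoid Q] [Module ℂ Q] :
    IsTensorFactor ((Module.End.rTensorAlgHom ℂ T Q).comp Φ) := by
  intro w
  induction w using TensorProduct.induction_on with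
  | zero => exact Submodule.zero_mem _
  | add x y hx hy => exact Submodule.add_mem _ hx hy
  | tmul t q =>
    induction hΦ t using Submodule.span_induction with
    | mem t ht =>
      obtain ⟨m, ℓ, h⟩ := ht
      refine Submodule.subset_span ⟨m, (TensorProduct.mk ℂ T Q).flip q ∘ₗ ℓ, fun g => ?_⟩
      exact congrArg (· ⊗ₜ[ℂ] q) (h g)
    | zero => simp
    | add x y _ _ hx hy =>
      rw [TensorProduct.add_tmul]
      exact Submodule.add_mem _ hx hy
    | smul c x _ hx =>
      rw [← TensorProduct.smul_tmul']
      exact Submodule.smul_mem _ c hx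

theorem lTensor (hΦ : IsTensorFactor Φ) (Q : Type*) [AddCommMonoid Q] [Module ℂ Q] :
    IsTensorFactor ((Module.End.lTensorAlgHom ℂ T Q).comp Φ) := by
  intro w
  induction w using TensorProduct.induction_on with
  | zero => exact Submodule.zero_mem _
  | add x y hx hy => exact Submodule.add_mem _ hx hy
  | tmul q t =>
    induction hΦ t using Submodule.span_induction with
    | mem t ht =>
      obtain ⟨m, ℓ, h⟩ := ht
      refine Submodule.subset_span ⟨m, TensorProduct.mk ℂ Q T q ∘ₗ ℓ, fun g => ?_⟩
      exact congrArg (q ⊗ₜ[ℂ] ·) (h g)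
    | zero => simp
    | add x y _ _ hx hy =>
      rw [TensorProduct.tmul_add]
      exact Submodule.add_mem _ hx hy
    | smul c x _ hx =>
      rw [TensorProduct.tmul_smul]
      exact Submodule.smul_mem _ c hx

end IsTensorFactor

end TensorFactors

/-! ### Single-factor operators on a finite tensor product -/

section PiTensorFactors

variable {n : ℕ} {M : Fin n → Type*} [∀ i, AddCommGroup (M i)] [∀ i, Module ℂ (M i)]

theorem factorEnd_tprod (i : Fin n) (f : Module.End ℂ (M i)) (v : ∀ i, M i) :
    factorEnd i f (PiTensorProduct.tprod ℂ v) =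
      PiTensorProduct.tprod ℂ (Function.update v i (f (v i))) := by
  rw [factorEnd, PiTensorProduct.map_tprod]
  refine congrArg _ (funext fun j => ?_)
  by_cases h : j = i
  · subst h; simp
  · simp [h]

/-- `factorEnd` as a homomorphism of algebras. -/
noncomputable def factorEndHom (i : Fin n) : Module.End ℂ (M i) →ₐ[ℂ] Module.End ℂ (⨂[ℂ] i, M i) :=
  AlgHom.ofLinearMap
    { toFun := factorEnd i
      map_add' := factorEnd_add i
      map_smul' := factorEnd_smul i }
    (by
      refine PiTensorProduct.ext (MultilinearMap.ext fun v => ?_)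
      simp [factorEnd_tprod])
    (factorEnd_mul i)

theorem factorEndHom_apply (i : Fin n) (f : Module.End ℂ (M i)) :
    factorEndHom i f = factorEnd i f := rfl

theorem isTensorFactor_factorEndHom (i : Fin n) : IsTensorFactor (factorEndHom (M := M) i) := by
  intro w
  induction w using PiTensorProduct.induction_on with
  | smul_tprod r v =>
    refine Submodule.smul_mem _ r (Submodule.subset_span
      ⟨v i, (PiTensorProduct.tprod ℂ).toLinearMap v i, fun g => ?_⟩)
    rw [factorEndHom_apply, factorEnd_tprod]
    rfl
  | add x y hx hy => exact Submodule.add_mem _ hx hy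

/-- A tensor product of operators is the product of commuting operators that each act on one factor.
-/
theorem map_mem_of_factorEnd_mem {R : Subalgebra ℂ (Module.End ℂ (⨂[ℂ] i, M i))}
    (h : ∀ i f, factorEnd i f ∈ R) (f : ∀ i, Module.End ℂ (M i)) : PiTensorProduct.map f ∈ R := by
  classical
  have key : PiTensorProduct.mapMonoidHom (R := ℂ) (s := M) _ = PiTensorProduct.map f :=
    congrArg PiTensorProduct.mapMonoidHom (Finset.noncommProd_mulSingle f)
  rw [← key]
  have h' := Finset.map_noncommProd Finset.univ (fun i => Pi.mulSingle i (f i))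
    (fun i _ j _ _ => Pi.mulSingle_apply_commute f i j)
    (PiTensorProduct.mapMonoidHom (R := ℂ) (s := M))
  exact h' ▸ Submonoid.noncommProd_mem R.toSubmonoid _ _ _ fun i _ => h i (f i)

/-- The matrix units with respect to the product of bases of the factors. -/
theorem exists_map_eq_coord_smul {κ : Fin n → Type*} (b : ∀ i, Module.Basis (κ i) ℂ (M i))
    (p q : ∀ i, κ i) : ∃ f : ∀ i, Module.End ℂ (M i), ∀ w, PiTensorProduct.map f w =
      (Basis.piTensorProduct b).repr w p • Basis.piTensorProduct b q := by
  -- On each factor, the rank one operator sending the basis vector `p i` to `q i` and the others to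
  -- `0`.
  refine ⟨fun i => ((b i).coord (p i)).smulRight (b i (q i)), fun w => ?_⟩
  induction w using PiTensorProduct.induction_on with
  | smul_tprod r v =>
    simp only [map_smul, PiTensorProduct.map_tprod, LinearMap.smulRight_apply,
      Finsupp.smul_apply, Basis.piTensorProduct_repr_tprod_apply, Basis.piTensorProduct_apply,
      Module.Basis.coord_apply]
    rw [MultilinearMap.map_smul_univ, smul_smul, smul_eq_mul, mul_smul]
  | add x y hx hy => rw [map_add, hx, hy, map_add, Finsupp.add_apply, add_smul]

end PiTensorFactors

/-! ### The mixed tensor product and its stable subspaces -/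

section MixedTensor

variable {m₁ m₂ : ℕ} {M₁ : Fin m₁ → Type*} {M₂ : Fin m₂ → Type*} {V : Type*}
  [∀ i, AddCommGroup (M₁ i)] [∀ i, Module ℂ (M₁ i)]
  [∀ i, AddCommGroup (M₂ i)] [∀ i, Module ℂ (M₂ i)] [AddCommGroup V] [Module ℂ V]

variable (M₂ V) in
/-- The action of endomorphisms of a factor of the first family. -/
noncomputable def leftFactor (i : Fin m₁) :
    Module.End ℂ (M₁ i) →ₐ[ℂ] Module.End ℂ (((⨂[ℂ] i, M₁ i) ⊗[ℂ] (⨂[ℂ] i, M₂ i)) ⊗[ℂ] V) :=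
  (Module.End.rTensorAlgHom ℂ _ V).comp
    ((Module.End.rTensorAlgHom ℂ _ (⨂[ℂ] i, M₂ i)).comp (factorEndHom i))

variable (M₁ V) in
/-- The action of endomorphisms of a factor of the second family. -/
noncomputable def rightFactor (i : Fin m₂) :
    Module.End ℂ (M₂ i) →ₐ[ℂ] Module.End ℂ (((⨂[ℂ] i, M₁ i) ⊗[ℂ] (⨂[ℂ] i, M₂ i)) ⊗[ℂ] V) :=
  (Module.End.rTensorAlgHom ℂ _ V).comp
    ((Module.End.lTensorAlgHom ℂ _ (⨂[ℂ] i, M₁ i)).comp (factorEndHom i))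

variable (M₁ M₂ V) in
/-- The action of endomorphisms of the last factor. -/
noncomputable def lastFactor :
    Module.End ℂ V →ₐ[ℂ] Module.End ℂ (((⨂[ℂ] i, M₁ i) ⊗[ℂ] (⨂[ℂ] i, M₂ i)) ⊗[ℂ] V) :=
  Module.End.lTensorAlgHom ℂ V _

theorem leftFactor_tmul (i : Fin m₁) (f : Module.End ℂ (M₁ i)) (p : ⨂[ℂ] i, M₁ i)
    (q : ⨂[ℂ] i, M₂ i) (v : V) :
    leftFactor M₂ V i f ((p ⊗ₜ q) ⊗ₜ v) = (factorEnd i f p ⊗ₜ q) ⊗ₜ v := rfl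

theorem rightFactor_tmul (i : Fin m₂) (f : Module.End ℂ (M₂ i)) (p : ⨂[ℂ] i, M₁ i)
    (q : ⨂[ℂ] i, M₂ i) (v : V) :
    rightFactor M₁ V i f ((p ⊗ₜ q) ⊗ₜ v) = (p ⊗ₜ factorEnd i f q) ⊗ₜ v := rfl

theorem lastFactor_tmul (f : Module.End ℂ V) (p : ⨂[ℂ] i, M₁ i) (q : ⨂[ℂ] i, M₂ i) (v : V) :
    lastFactor M₁ M₂ V f ((p ⊗ₜ q) ⊗ₜ v) = (p ⊗ₜ q) ⊗ₜ f v := rfl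

theorem isTensorFactor_leftFactor (i : Fin m₁) :
    IsTensorFactor (leftFactor (M₁ := M₁) M₂ V i) :=
  ((isTensorFactor_factorEndHom i).rTensor _).rTensor _

theorem isTensorFactor_rightFactor (i : Fin m₂) :
    IsTensorFactor (rightFactor (M₂ := M₂) M₁ V i) :=
  ((isTensorFactor_factorEndHom i).lTensor _).rTensor _

theorem end_ext_tmul {f g : Module.End ℂ (((⨂[ℂ] i, M₁ i) ⊗[ℂ] (⨂[ℂ] i, M₂ i)) ⊗[ℂ] V)}
    (h : ∀ p q v, f ((p ⊗ₜ q) ⊗ₜ v) = g ((p ⊗ₜ q) ⊗ₜ v)) : f = g :=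
  TensorProduct.ext (TensorProduct.ext (LinearMap.ext fun p => LinearMap.ext fun q =>
    LinearMap.ext fun v => h p q v))

theorem leftFactor_commute_leftFactor {i j : Fin m₁} (hij : i ≠ j) (f : Module.End ℂ (M₁ i))
    (g : Module.End ℂ (M₁ j)) : Commute (leftFactor M₂ V i f) (leftFactor M₂ V j g) :=
  have h : Commute (factorEndHom i f) (factorEndHom j g) := factorEnd_commute hij f g
  (h.map (Module.End.rTensorAlgHom ℂ _ (⨂[ℂ] i, M₂ i))).map (Module.End.rTensorAlgHom ℂ _ V)

theorem rightFactor_commute_rightFactor {i j : Fin m₂} (hij : i ≠ j) (f : Module.End ℂ (M₂ i))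
    (g : Module.End ℂ (M₂ j)) : Commute (rightFactor M₁ V i f) (rightFactor M₁ V j g) :=
  have h : Commute (factorEndHom i f) (factorEndHom j g) := factorEnd_commute hij f g
  (h.map (Module.End.lTensorAlgHom ℂ _ (⨂[ℂ] i, M₁ i))).map (Module.End.rTensorAlgHom ℂ _ V)

theorem leftFactor_commute_rightFactor (i : Fin m₁) (j : Fin m₂) (f : Module.End ℂ (M₁ i))
    (g : Module.End ℂ (M₂ j)) : Commute (leftFactor M₂ V i f) (rightFactor M₁ V j g) :=
  end_ext_tmul fun p q v => by
    simp only [Module.End.mul_apply, leftFactor_tmul, rightFactor_tmul]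

theorem leftFactor_commute_lastFactor (i : Fin m₁) (f : Module.End ℂ (M₁ i))
    (g : Module.End ℂ V) : Commute (leftFactor M₂ V i f) (lastFactor M₁ M₂ V g) :=
  end_ext_tmul fun p q v => by
    simp only [Module.End.mul_apply, leftFactor_tmul, lastFactor_tmul]

theorem rightFactor_commute_lastFactor (i : Fin m₂) (f : Module.End ℂ (M₂ i))
    (g : Module.End ℂ V) : Commute (rightFactor M₁ V i f) (lastFactor M₁ M₂ V g) :=
  end_ext_tmul fun p q v => by
    simp only [Module.End.mul_apply, rightFactor_tmul, lastFactor_tmul]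

/-- The product of the rank one operators of both families moves the `V`-coefficient at position `p`
to position `q` and erases all others. -/
theorem exists_matrixUnit {κ₁ : Fin m₁ → Type*} (b₁ : ∀ i, Module.Basis (κ₁ i) ℂ (M₁ i))
    {κ₂ : Fin m₂ → Type*} (b₂ : ∀ i, Module.Basis (κ₂ i) ℂ (M₂ i))
    [DecidableEq ((∀ i, κ₁ i) × (∀ i, κ₂ i))]
    (W : Submodule ℂ (((⨂[ℂ] i, M₁ i) ⊗[ℂ] (⨂[ℂ] i, M₂ i)) ⊗[ℂ] V))
    (h₁ : ∀ i f, leftFactor M₂ V i f ∈ stabilizer W)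
    (h₂ : ∀ i f, rightFactor M₁ V i f ∈ stabilizer W)
    (p q : (∀ i, κ₁ i) × (∀ i, κ₂ i)) : ∃ F ∈ stabilizer W, ∀ w,
      F w = (Basis.piTensorProduct b₁).tensorProduct (Basis.piTensorProduct b₂) q ⊗ₜ
        TensorProduct.equivFinsuppOfBasisLeft
          ((Basis.piTensorProduct b₁).tensorProduct (Basis.piTensorProduct b₂)) w p := by
  obtain ⟨f, hf⟩ := exists_map_eq_coord_smul b₁ p.1 q.1
  obtain ⟨g, hg⟩ := exists_map_eq_coord_smul b₂ p.2 q.2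
  have hf' := map_mem_of_factorEnd_mem (R := ((stabilizer W).comap
    (Module.End.rTensorAlgHom ℂ _ V)).comap (Module.End.rTensorAlgHom ℂ _ (⨂[ℂ] i, M₂ i)))
    h₁ f
  have hg' := map_mem_of_factorEnd_mem (R := ((stabilizer W).comap
    (Module.End.rTensorAlgHom ℂ _ V)).comap (Module.End.lTensorAlgHom ℂ _ (⨂[ℂ] i, M₁ i)))
    h₂ g
  refine ⟨_, (stabilizer W).mul_mem hf' hg', fun w => ?_⟩
  induction w using TensorProduct.induction_on with
  | zero => simp
  | add x y hx hy => rw [map_add, hx, hy, map_add, Finsupp.add_apply, TensorProduct.tmul_add]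
  | tmul x v =>
    induction x using TensorProduct.induction_on with
    | zero => simp
    | add x y hx hy =>
      rw [TensorProduct.add_tmul, map_add, hx, hy, map_add, Finsupp.add_apply,
        TensorProduct.tmul_add]
    | tmul y z =>
      change (PiTensorProduct.map f y ⊗ₜ[ℂ] PiTensorProduct.map g z) ⊗ₜ[ℂ] v = _
      rw [hf, hg, TensorProduct.equivFinsuppOfBasisLeft_apply_tmul_apply,
        Module.Basis.tensorProduct_repr_tmul_apply, Module.Basis.tensorProduct_apply]
      simp only [TensorProduct.tmul_smul, ← TensorProduct.smul_tmul', smul_smul, smul_eq_mul,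
        mul_comm]

variable [LieRingModule PlanarGCA V] [LieModule ℂ PlanarGCA V]

/-- A subspace stable under all endomorphisms of the factors of both families and under the
action on an irreducible last factor is trivial. -/
theorem eq_top_of_mem_stabilizer [LieModule.IsIrreducible ℂ PlanarGCA V]
    (W : Submodule ℂ (((⨂[ℂ] i, M₁ i) ⊗[ℂ] (⨂[ℂ] i, M₂ i)) ⊗[ℂ] V)) (hW : W ≠ ⊥)
    (h₁ : ∀ i f, leftFactor M₂ V i f ∈ stabilizer W)
    (h₂ : ∀ i f, rightFactor M₁ V i f ∈ stabilizer W)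
    (h₃ : ∀ x, lastFactor M₁ M₂ V (LieModule.toEnd ℂ PlanarGCA V x) ∈ stabilizer W) :
    W = ⊤ := by
  classical
  let b₁ := fun i => Module.Basis.ofVectorSpace ℂ (M₁ i)
  let b₂ := fun i => Module.Basis.ofVectorSpace ℂ (M₂ i)
  let B := (Basis.piTensorProduct b₁).tensorProduct (Basis.piTensorProduct b₂)
  let E := TensorProduct.equivFinsuppOfBasisLeft (N := V) B
  have hE : ∀ w ∈ W, ∀ p q, B q ⊗ₜ E w p ∈ W := by
    intro w hw p q
    obtain ⟨F, hF, h⟩ := exists_matrixUnit b₁ b₂ W h₁ h₂ p q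
    have hFw := hF w hw
    rwa [h w] at hFw
  -- The vectors that may be placed in every position. By `hE` this submodule contains all
  -- coefficients of all elements of `W`.
  let V' : LieSubmodule ℂ PlanarGCA V :=
    { carrier := {v | ∀ q, B q ⊗ₜ v ∈ W}
      add_mem' := fun ha hb q => by
        rw [TensorProduct.tmul_add]
        exact W.add_mem (ha q) (hb q)
      zero_mem' := fun q => by
        rw [TensorProduct.tmul_zero]
        exact W.zero_mem
      smul_mem' := fun c v hv q => by
        rw [TensorProduct.tmul_smul]
        exact W.smul_mem c (hv q)
      lie_mem := fun {x v} hv q => h₃ x _ (hv q) }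
  have hV' : V' = ⊤ := by
    refine (IsSimpleOrder.eq_bot_or_eq_top V').resolve_left fun hbot => ?_
    obtain ⟨w, hw, hw0⟩ := W.ne_bot_iff.1 hW
    refine hw0 (E.injective ?_)
    rw [map_zero]
    ext1 p
    have : E w p ∈ V' := fun q => hE w hw p q
    rwa [hbot, LieSubmodule.mem_bot] at this
  rw [eq_top_iff]
  rintro w -
  rw [← E.symm_apply_apply w, TensorProduct.equivFinsuppOfBasisLeft_symm_apply]
  refine Submodule.sum_mem _ fun q _ => ?_
  have : E w q ∈ V' := hV' ▸ LieSubmodule.mem_top _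
  exact this q

variable [∀ i, LieRingModule PlanarGCA (M₁ i)] [∀ i, LieModule ℂ PlanarGCA (M₁ i)]
  [∀ i, LieRingModule PlanarGCA (M₂ i)] [∀ i, LieModule ℂ PlanarGCA (M₂ i)]

theorem toEnd_mixedTensor (x : PlanarGCA) :
    LieModule.toEnd ℂ PlanarGCA (((⨂[ℂ] i, M₁ i) ⊗[ℂ] (⨂[ℂ] i, M₂ i)) ⊗[ℂ] V) x =
      ∑ i, leftFactor M₂ V i (LieModule.toEnd ℂ PlanarGCA (M₁ i) x) +
      ∑ i, rightFactor M₁ V i (LieModule.toEnd ℂ PlanarGCA (M₂ i) x) +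
      lastFactor M₁ M₂ V (LieModule.toEnd ℂ PlanarGCA V x) := by
  refine end_ext_tmul fun p q v => ?_
  have hp : ⁅x, p⁆ = ∑ i, factorEnd i (LieModule.toEnd ℂ PlanarGCA (M₁ i) x) p :=
    LinearMap.sum_apply _ _ _
  have hq : ⁅x, q⁆ = ∑ i, factorEnd i (LieModule.toEnd ℂ PlanarGCA (M₂ i) x) q :=
    LinearMap.sum_apply _ _ _
  simp only [LieModule.toEnd_apply_apply, TensorProduct.LieModule.lie_tmul_right,
    LinearMap.add_apply, LinearMap.sum_apply, leftFactor_tmul, rightFactor_tmul,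
    lastFactor_tmul, hp, hq, TensorProduct.add_tmul, TensorProduct.sum_tmul,
    TensorProduct.tmul_sum]

end MixedTensor

/-- A module on which the basis vectors act by exponential polynomials in the degree, and whose
action generates a dense algebra of endomorphisms. -/
structure IsExpDense (μ : ℂˣ) (M : Type*) [AddCommGroup M] [Module ℂ M]
    [LieRingModule PlanarGCA M] [LieModule ℂ PlanarGCA M] : Prop where
  nontrivial : Nontrivial M
  isExpPoly : ∀ Y (m : M), IsExpPoly (μ : ℂ) fun n => ⁅gen Y n, m⁆
  dense : ∀ R : Subalgebra ℂ (Module.End ℂ M),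
    (∀ Y n, LieModule.toEnd ℂ PlanarGCA M (gen Y n) ∈ R) →
    ∀ (g : Module.End ℂ M) (s : Finset M), ∃ r ∈ R, ∀ m ∈ s, r m = g m

/-! ### Distinct parameters give a simple module -/

section Irreducible

variable {m₁ m₂ : ℕ} {M₁ : Fin m₁ → Type*} {M₂ : Fin m₂ → Type*} {V : Type*}
  [∀ i, AddCommGroup (M₁ i)] [∀ i, Module ℂ (M₁ i)]
  [∀ i, AddCommGroup (M₂ i)] [∀ i, Module ℂ (M₂ i)] [AddCommGroup V] [Module ℂ V]
  [LieRingModule PlanarGCA V] [LieModule ℂ PlanarGCA V]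

theorem nontrivial_piTensorProduct {n : ℕ} {M : Fin n → Type*} [∀ i, AddCommGroup (M i)]
    [∀ i, Module ℂ (M i)] (h : ∀ i, Nontrivial (M i)) : Nontrivial (⨂[ℂ] i, M i) := by
  have b := fun i => Module.Basis.ofVectorSpace ℂ (M i)
  have := fun i => (b i).index_nonempty
  have p : ∀ i, Module.Basis.ofVectorSpaceIndex ℂ (M i) := fun i => Classical.arbitrary _
  exact ⟨_, 0, (Basis.piTensorProduct b).ne_zero p⟩

theorem mem_of_gen_mem {A : Type*} [AddCommGroup A] [Module ℂ A] (f : PlanarGCA →ₗ[ℂ] A)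
    (S : Submodule ℂ A) (h : ∀ Y n, f (gen Y n) ∈ S) (x : PlanarGCA) : f x ∈ S := by
  have hx : x ∈ Submodule.span ℂ (Set.range basis) := by rw [basis.span_eq]; trivial
  induction hx using Submodule.span_induction with
  | mem y hy =>
    obtain ⟨⟨Y, n⟩, rfl⟩ := hy
    exact h Y n
  | zero => rw [map_zero]; exact S.zero_mem
  | add a b _ _ ha hb => rw [map_add]; exact S.add_mem ha hb
  | smul c a _ ha => rw [map_smul]; exact S.smul_mem c ha

/-- A tensor involves finitely many vectors of `V`, so the largest of their bounds serves. -/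
theorem IsRestricted.exists_lie_gen_eq_zero (hV : IsRestricted V) (Y : Gen)
    (w : ((⨂[ℂ] i, M₁ i) ⊗[ℂ] (⨂[ℂ] i, M₂ i)) ⊗[ℂ] V) :
    ∃ N : ℤ, ∀ n, N ≤ n →
      lastFactor M₁ M₂ V (LieModule.toEnd ℂ PlanarGCA V (gen Y n)) w = 0 := by
  induction w using TensorProduct.induction_on with
  | zero => exact ⟨0, fun n _ => map_zero _⟩
  | add x y hx hy =>
    obtain ⟨N, hN⟩ := hx
    obtain ⟨N', hN'⟩ := hy
    refine ⟨max N N', fun n hn => ?_⟩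
    rw [map_add, hN n ((le_max_left _ _).trans hn), hN' n ((le_max_right _ _).trans hn), add_zero]
  | tmul x v =>
    obtain ⟨N, hN⟩ := hV v
    refine ⟨N, fun n hn => ?_⟩
    change x ⊗ₜ[ℂ] ⁅gen Y n, v⁆ = 0
    rw [hN n hn _ (Submodule.subset_span (by cases Y <;> simp)), TensorProduct.tmul_zero]

variable [∀ i, LieRingModule PlanarGCA (M₁ i)] [∀ i, LieModule ℂ PlanarGCA (M₁ i)]
  [∀ i, LieRingModule PlanarGCA (M₂ i)] [∀ i, LieModule ℂ PlanarGCA (M₂ i)]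

variable {μ₁ : Fin m₁ → ℂˣ} {μ₂ : Fin m₂ → ℂˣ}

/-- A subspace stable under the algebra is stable under the action on each factor. -/
theorem factor_gen_mem_stabilizer (hM₁ : ∀ i, IsExpDense (μ₁ i) (M₁ i))
    (hM₂ : ∀ i, IsExpDense (μ₂ i) (M₂ i)) (hV : IsRestricted V)
    (hμ : Function.Injective (Sum.elim μ₁ μ₂))
    (W : Submodule ℂ (((⨂[ℂ] i, M₁ i) ⊗[ℂ] (⨂[ℂ] i, M₂ i)) ⊗[ℂ] V))
    (hW : ∀ x, ∑ i, leftFactor M₂ V i (LieModule.toEnd ℂ PlanarGCA (M₁ i) x) +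
      ∑ i, rightFactor M₁ V i (LieModule.toEnd ℂ PlanarGCA (M₂ i) x) +
      lastFactor M₁ M₂ V (LieModule.toEnd ℂ PlanarGCA V x) ∈ stabilizer W)
    (Y : Gen) (n : ℤ) :
    (∀ i, leftFactor M₂ V i (LieModule.toEnd ℂ PlanarGCA (M₁ i) (gen Y n)) ∈ stabilizer W) ∧
    ∀ i, rightFactor M₁ V i (LieModule.toEnd ℂ PlanarGCA (M₂ i) (gen Y n)) ∈ stabilizer W := by
  -- Passing to the quotient by `W` turns stability of `W` into the vanishing of a sum of sequences
  -- in the degree.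
  let u (w : ((⨂[ℂ] i, M₁ i) ⊗[ℂ] (⨂[ℂ] i, M₂ i)) ⊗[ℂ] V) : Fin m₁ ⊕ Fin m₂ → ℤ →
      (((⨂[ℂ] i, M₁ i) ⊗[ℂ] (⨂[ℂ] i, M₂ i)) ⊗[ℂ] V) ⧸ W :=
    Sum.elim
      (fun i n => W.mkQ (leftFactor M₂ V i (LieModule.toEnd ℂ PlanarGCA (M₁ i) (gen Y n)) w))
      (fun i n => W.mkQ (rightFactor M₁ V i (LieModule.toEnd ℂ PlanarGCA (M₂ i) (gen Y n)) w))
  have hu : ∀ w k, IsExpPoly ((Sum.elim μ₁ μ₂ k : ℂˣ) : ℂ) (u w k) := by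
    rintro w (i | i)
    · exact (isTensorFactor_leftFactor i).isExpPoly W.mkQ
        (ρ := fun n => LieModule.toEnd ℂ PlanarGCA (M₁ i) (gen Y n)) ((hM₁ i).isExpPoly Y) w
    · exact (isTensorFactor_rightFactor i).isExpPoly W.mkQ
        (ρ := fun n => LieModule.toEnd ℂ PlanarGCA (M₂ i) (gen Y n)) ((hM₂ i).isExpPoly Y) w
  have key : ∀ w ∈ W, ∀ k, u w k n = 0 := by
    intro w hw k
    obtain ⟨N, hN⟩ := hV.exists_lie_gen_eq_zero (M₁ := M₁) (M₂ := M₂) Y w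
    refine eq_zero_of_sum_isExpPoly hμ (hu w) (z := fun n => W.mkQ
        (lastFactor M₁ M₂ V (LieModule.toEnd ℂ PlanarGCA V (gen Y n)) w))
      ⟨N, fun n hn => by rw [hN n hn, map_zero]⟩ (fun n => ?_) k n
    have h := (Submodule.Quotient.mk_eq_zero W).2 (hW (gen Y n) w hw)
    rw [← Submodule.mkQ_apply, LinearMap.add_apply, LinearMap.add_apply, LinearMap.sum_apply,
      LinearMap.sum_apply, map_add, map_add, map_sum, map_sum] at h
    rw [Fintype.sum_sum_type]
    exact h
  exact ⟨fun i w hw => (Submodule.Quotient.mk_eq_zero W).1 (key w hw (Sum.inl i)),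
    fun i w hw => (Submodule.Quotient.mk_eq_zero W).1 (key w hw (Sum.inr i))⟩

theorem isIrreducible_mixedTensor (hM₁ : ∀ i, IsExpDense (μ₁ i) (M₁ i))
    (hM₂ : ∀ i, IsExpDense (μ₂ i) (M₂ i)) [LieModule.IsIrreducible ℂ PlanarGCA V]
    (hV : IsRestricted V) (hμ : Function.Injective (Sum.elim μ₁ μ₂)) :
    LieModule.IsIrreducible ℂ PlanarGCA (((⨂[ℂ] i, M₁ i) ⊗[ℂ] (⨂[ℂ] i, M₂ i)) ⊗[ℂ] V) := by
  have := nontrivial_piTensorProduct fun i => (hM₁ i).nontrivial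
  have := nontrivial_piTensorProduct fun i => (hM₂ i).nontrivial
  have : Nontrivial V := (LieSubmodule.nontrivial_iff ℂ PlanarGCA V).1 inferInstance
  refine LieModule.IsIrreducible.mk fun W hW => ?_
  have hW' : ∀ x, ∑ i, leftFactor M₂ V i (LieModule.toEnd ℂ PlanarGCA (M₁ i) x) +
      ∑ i, rightFactor M₁ V i (LieModule.toEnd ℂ PlanarGCA (M₂ i) x) +
      lastFactor M₁ M₂ V (LieModule.toEnd ℂ PlanarGCA V x) ∈ stabilizer W.toSubmodule := by
    intro x w hw
    rw [← toEnd_mixedTensor]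
    exact W.lie_mem hw
  have hgen := factor_gen_mem_stabilizer hM₁ hM₂ hV hμ _ hW'
  have h₁ : ∀ i f, leftFactor M₂ V i f ∈ stabilizer W.toSubmodule := fun i f =>
    (isTensorFactor_leftFactor i).mem_stabilizer_of_dense _
      ((hM₁ i).dense _ fun Y n => (hgen Y n).1 i) f
  have h₂ : ∀ i f, rightFactor M₁ V i f ∈ stabilizer W.toSubmodule := fun i f =>
    (isTensorFactor_rightFactor i).mem_stabilizer_of_dense _
      ((hM₂ i).dense _ fun Y n => (hgen Y n).2 i) f
  -- The action on `V` is the total action minus the actions on the polynomial factors, all of which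
  -- preserve `W`.
  have h₃ : ∀ x, lastFactor M₁ M₂ V (LieModule.toEnd ℂ PlanarGCA V x) ∈
      stabilizer W.toSubmodule := fun x w hw => by
    have hs := (stabilizer W.toSubmodule).add_mem
      (sum_mem fun i (_ : i ∈ Finset.univ) => h₁ i (LieModule.toEnd ℂ PlanarGCA (M₁ i) x))
      (sum_mem fun i (_ : i ∈ Finset.univ) => h₂ i (LieModule.toEnd ℂ PlanarGCA (M₂ i) x)) w hw
    exact (W.toSubmodule.add_mem_iff_right hs).1 (hW' x w hw)
  rw [← LieSubmodule.toSubmodule_eq_top]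
  refine eq_top_of_mem_stabilizer _ ?_ h₁ h₂ h₃
  rwa [Ne, LieSubmodule.toSubmodule_eq_bot]

end Irreducible

/-- Operators behaving like the translations `f(s, t) ↦ f(s - a, t)` of `ℂ[s, t]`, with a fixed
vector `e` like the constant polynomial `1`. -/
structure IsShiftFamily (μ : ℂˣ) (M : Type*) [AddCommGroup M] [Module ℂ M]
    [LieRingModule PlanarGCA M] [LieModule ℂ PlanarGCA M] (τ : ℤ → Module.End ℂ M) (e : M) :
    Prop where
  ne_zero : e ≠ 0
  apply_eq : ∀ a, τ a e = e
  mul_toEnd_L : ∀ a n, τ a * LieModule.toEnd ℂ PlanarGCA M (gen .L n) =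
    LieModule.toEnd ℂ PlanarGCA M (gen .L n) * τ a - ((a : ℂ) * (μ ^ n : ℂˣ)) • τ (a + n)
  commute : ∀ Y, Y ≠ .L → ∀ a n, Commute (τ a) (LieModule.toEnd ℂ PlanarGCA M (gen Y n))

/-! ### Equal parameters give a proper submodule -/

section NotIrreducible

variable {M M' T : Type*} [AddCommGroup M] [Module ℂ M] [LieRingModule PlanarGCA M]
  [LieModule ℂ PlanarGCA M] [AddCommGroup M'] [Module ℂ M'] [LieRingModule PlanarGCA M']
  [LieModule ℂ PlanarGCA M'] [AddCommGroup T] [Module ℂ T] [LieRingModule PlanarGCA T]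
  [LieModule ℂ PlanarGCA T]

/-- If two tensor factors have shift operators for the same parameter, then the vectors on which
these shifts agree form a proper nonzero submodule. -/
theorem not_isIrreducible_of_isShiftFamily {μ : ℂˣ} {τ : ℤ → Module.End ℂ M} {e : M}
    (hτ : IsShiftFamily μ M τ e) {τ' : ℤ → Module.End ℂ M'} {e' : M'}
    (hτ' : IsShiftFamily μ M' τ' e') (Φ : Module.End ℂ M →ₐ[ℂ] Module.End ℂ T)
    (Φ' : Module.End ℂ M' →ₐ[ℂ] Module.End ℂ T) (hΦ : ∀ f g, Commute (Φ f) (Φ' g))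
    (hact : ∀ x, ∃ r : Module.End ℂ T, (∀ f, Commute (Φ f) r) ∧ (∀ g, Commute (Φ' g) r) ∧
      LieModule.toEnd ℂ PlanarGCA T x =
        Φ (LieModule.toEnd ℂ PlanarGCA M x) + Φ' (LieModule.toEnd ℂ PlanarGCA M' x) + r)
    {u : T} (hu : u ≠ 0) (hτu : ∀ a, Φ (τ a) u = u) (hτu' : ∀ a, Φ' (τ' a) u = u) :
    ¬ LieModule.IsIrreducible ℂ PlanarGCA T := by
  intro hirr
  let D : ℤ → Module.End ℂ T := fun a => Φ (τ a) - Φ' (τ' a)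
  let K : Submodule ℂ T := ⨅ a, LinearMap.ker (D a)
  have hK : ∀ {w}, w ∈ K ↔ ∀ a, D a w = 0 := fun {w} => by
    simp only [K, Submodule.mem_iInf, LinearMap.mem_ker]
  -- The correction scalar `c` is the same for both factors because they share `μ`; hence the
  -- correction is again a multiple of some `D`, and `K` is stable.
  have hD : ∀ Y n a, ∃ c : ℂ, D a * LieModule.toEnd ℂ PlanarGCA T (gen Y n) =
      LieModule.toEnd ℂ PlanarGCA T (gen Y n) * D a - c • D (a + n) := by
    intro Y n a
    obtain ⟨r, hr, hr', h⟩ := hact (gen Y n)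
    have h1 := (hΦ (τ a) (LieModule.toEnd ℂ PlanarGCA M' (gen Y n))).eq
    have h2 := (hΦ (LieModule.toEnd ℂ PlanarGCA M (gen Y n)) (τ' a)).eq
    have h3 := (hr (τ a)).eq
    have h4 := (hr' (τ' a)).eq
    have hc : ∃ c : ℂ, τ a * LieModule.toEnd ℂ PlanarGCA M (gen Y n) =
          LieModule.toEnd ℂ PlanarGCA M (gen Y n) * τ a - c • τ (a + n) ∧
        τ' a * LieModule.toEnd ℂ PlanarGCA M' (gen Y n) =
          LieModule.toEnd ℂ PlanarGCA M' (gen Y n) * τ' a - c • τ' (a + n) := by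
      by_cases hY : Y = .L
      · subst hY
        exact ⟨_, hτ.mul_toEnd_L a n, hτ'.mul_toEnd_L a n⟩
      · exact ⟨0, by simpa using (hτ.commute Y hY a n).eq,
          by simpa using (hτ'.commute Y hY a n).eq⟩
    obtain ⟨c, hc1, hc2⟩ := hc
    have h5 := congrArg Φ hc1
    have h6 := congrArg Φ' hc2
    simp only [map_mul, map_sub, map_smul] at h5 h6
    refine ⟨c, ?_⟩
    rw [h]
    simp only [D, sub_mul, mul_sub, mul_add, add_mul, smul_sub, h1, ← h2, h3, h4, h5, h6]
    abel
  have hgen : ∀ Y n, LieModule.toEnd ℂ PlanarGCA T (gen Y n) ∈ stabilizer K := by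
    intro Y n w hw
    rw [hK] at hw ⊢
    intro a
    obtain ⟨c, hc⟩ := hD Y n a
    rw [← Module.End.mul_apply, hc, LinearMap.sub_apply, Module.End.mul_apply,
      LinearMap.smul_apply, hw, hw, map_zero, smul_zero, sub_zero]
  let N : LieSubmodule ℂ PlanarGCA T :=
    { K with
      lie_mem := fun {x w} hw => mem_of_gen_mem
        (LieModule.toEnd ℂ PlanarGCA T : PlanarGCA →ₗ[ℂ] Module.End ℂ T)
        (Subalgebra.toSubmodule (stabilizer K)) hgen x w hw }
  have huN : u ∈ N := hK.2 fun a => by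
    rw [LinearMap.sub_apply, hτu, hτu', sub_self]
  rcases IsSimpleOrder.eq_bot_or_eq_top N with hN | hN
  · rw [hN, LieSubmodule.mem_bot] at huN
    exact hu huN
  -- `K` is proper: `L_0` applied to one factor alone sends `u` to a vector that `D 1` maps to `-u`,
  -- since `τ 1 * L_0 = L_0 * τ 1 - τ 1`.
  · have hmem : Φ (LieModule.toEnd ℂ PlanarGCA M (gen .L 0)) u ∈ N := hN ▸ LieSubmodule.mem_top _
    have h := hK.1 hmem 1
    have hL := hτ.mul_toEnd_L 1 0
    simp only [Int.cast_one, zpow_zero, Units.val_one, mul_one, one_smul, add_zero] at hL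
    rw [LinearMap.sub_apply, ← Module.End.mul_apply, ← Module.End.mul_apply, ← map_mul, hL,
      ← (hΦ _ _).eq, map_sub, map_mul, LinearMap.sub_apply, Module.End.mul_apply,
      Module.End.mul_apply, hτu, hτu', sub_sub_cancel_left, neg_eq_zero] at h
    exact hu h

/-- Collects every summand except the `i`-th and `j`-th into one operator commuting with both
factors, so that all placements of the two factors are treated alike. -/
theorem not_isIrreducible_of_sum {μ : ℂˣ} {τ : ℤ → Module.End ℂ M} {e : M}
    (hτ : IsShiftFamily μ M τ e) {τ' : ℤ → Module.End ℂ M'} {e' : M'}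
    (hτ' : IsShiftFamily μ M' τ' e') (Φ : Module.End ℂ M →ₐ[ℂ] Module.End ℂ T)
    (Φ' : Module.End ℂ M' →ₐ[ℂ] Module.End ℂ T) {ι : Type*} [Fintype ι] {i j : ι} (hij : i ≠ j)
    (F : ι → PlanarGCA → Module.End ℂ T) (r : PlanarGCA → Module.End ℂ T)
    (hF : ∀ x, LieModule.toEnd ℂ PlanarGCA T x = ∑ k, F k x + r x)
    (hi : ∀ x, F i x = Φ (LieModule.toEnd ℂ PlanarGCA M x))
    (hj : ∀ x, F j x = Φ' (LieModule.toEnd ℂ PlanarGCA M' x))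
    (hΦ : ∀ f g, Commute (Φ f) (Φ' g)) (hΦF : ∀ k, k ≠ i → ∀ f x, Commute (Φ f) (F k x))
    (hΦF' : ∀ k, k ≠ j → ∀ f x, Commute (Φ' f) (F k x))
    (hr : ∀ f x, Commute (Φ f) (r x)) (hr' : ∀ f x, Commute (Φ' f) (r x))
    {u : T} (hu : u ≠ 0) (hτu : ∀ a, Φ (τ a) u = u) (hτu' : ∀ a, Φ' (τ' a) u = u) :
    ¬ LieModule.IsIrreducible ℂ PlanarGCA T := by
  classical
  refine not_isIrreducible_of_isShiftFamily hτ hτ' Φ Φ' hΦ (fun x => ⟨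
    ∑ k ∈ (Finset.univ.erase i).erase j, F k x + r x, fun f => ?_, fun f => ?_, ?_⟩) hu hτu hτu'
  · exact (Commute.sum_right _ _ _ fun k hk =>
      hΦF k (Finset.ne_of_mem_erase (Finset.mem_of_mem_erase hk)) f x).add_right (hr f x)
  · exact (Commute.sum_right _ _ _ fun k hk =>
      hΦF' k (Finset.ne_of_mem_erase hk) f x).add_right (hr' f x)
  · rw [hF, ← Finset.add_sum_erase _ _ (Finset.mem_univ i), ← Finset.add_sum_erase _ _
      (Finset.mem_erase.2 ⟨hij.symm, Finset.mem_univ j⟩), hi, hj]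
    abel

end NotIrreducible

/-- A product of functionals, each nonzero on its vector, is nonzero on the pure tensor. -/
theorem tprod_ne_zero {n : ℕ} {M : Fin n → Type*} [∀ i, AddCommGroup (M i)]
    [∀ i, Module ℂ (M i)] {e : ∀ i, M i} (he : ∀ i, e i ≠ 0) :
    PiTensorProduct.tprod ℂ e ≠ 0 := by
  have h : ∀ i, ∃ φ : Module.Dual ℂ (M i), φ (e i) ≠ 0 := fun i => by
    by_contra! hφ
    exact he i ((Module.forall_dual_apply_eq_zero_iff ℂ _).1 hφ)
  choose φ hφ using h
  intro h0
  have h1 := congrArg (PiTensorProduct.lift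
    ((MultilinearMap.mkPiAlgebra ℂ (Fin n) ℂ).compLinearMap φ)) h0
  rw [PiTensorProduct.lift.tprod, map_zero, MultilinearMap.compLinearMap_apply,
    MultilinearMap.mkPiAlgebra_apply] at h1
  exact Finset.prod_ne_zero_iff.2 (fun i _ => hφ i) h1

theorem tmul_ne_zero {A B : Type*} [AddCommGroup A] [Module ℂ A] [AddCommGroup B] [Module ℂ B]
    {a : A} {b : B} (ha : a ≠ 0) (hb : b ≠ 0) : a ⊗ₜ[ℂ] b ≠ 0 := by
  obtain ⟨φ, hφ⟩ : ∃ φ : Module.Dual ℂ A, φ a ≠ 0 := by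
    by_contra! hφ
    exact ha ((Module.forall_dual_apply_eq_zero_iff ℂ _).1 hφ)
  intro h0
  have h1 := congrArg ((TensorProduct.lid ℂ B).toLinearMap ∘ₗ φ.rTensor B) h0
  simp only [map_zero, LinearMap.comp_apply, LinearMap.rTensor_tmul, LinearEquiv.coe_coe,
    TensorProduct.lid_tmul] at h1
  exact smul_ne_zero hφ hb h1

/-! ### Coinciding parameters in the mixed tensor product -/

section Reducible

variable {m₁ m₂ : ℕ} {M₁ : Fin m₁ → Type*} {M₂ : Fin m₂ → Type*} {V : Type*}
  [∀ i, AddCommGroup (M₁ i)] [∀ i, Module ℂ (M₁ i)]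
  [∀ i, AddCommGroup (M₂ i)] [∀ i, Module ℂ (M₂ i)] [AddCommGroup V] [Module ℂ V]
  [∀ i, LieRingModule PlanarGCA (M₁ i)] [∀ i, LieModule ℂ PlanarGCA (M₁ i)]
  [∀ i, LieRingModule PlanarGCA (M₂ i)] [∀ i, LieModule ℂ PlanarGCA (M₂ i)]
  [LieRingModule PlanarGCA V] [LieModule ℂ PlanarGCA V]
  {μ₁ : Fin m₁ → ℂˣ} {μ₂ : Fin m₂ → ℂˣ}
  {τ₁ : ∀ i, ℤ → Module.End ℂ (M₁ i)} {τ₂ : ∀ i, ℤ → Module.End ℂ (M₂ i)}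
  {e₁ : ∀ i, M₁ i} {e₂ : ∀ i, M₂ i}

theorem not_isIrreducible_mixedTensor (h₁ : ∀ i, IsShiftFamily (μ₁ i) (M₁ i) (τ₁ i) (e₁ i))
    (h₂ : ∀ i, IsShiftFamily (μ₂ i) (M₂ i) (τ₂ i) (e₂ i)) [Nontrivial V]
    (hμ : ¬ Function.Injective (Sum.elim μ₁ μ₂)) :
    ¬ LieModule.IsIrreducible ℂ PlanarGCA
      (((⨂[ℂ] i, M₁ i) ⊗[ℂ] (⨂[ℂ] i, M₂ i)) ⊗[ℂ] V) := by
  obtain ⟨v, hv⟩ := exists_ne (0 : V)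
  have hu := tmul_ne_zero (tmul_ne_zero (tprod_ne_zero fun i => (h₁ i).ne_zero)
    (tprod_ne_zero fun i => (h₂ i).ne_zero)) hv
  have hl : ∀ i a, leftFactor M₂ V i (τ₁ i a)
      ((PiTensorProduct.tprod ℂ e₁ ⊗ₜ PiTensorProduct.tprod ℂ e₂) ⊗ₜ v) =
        (PiTensorProduct.tprod ℂ e₁ ⊗ₜ PiTensorProduct.tprod ℂ e₂) ⊗ₜ v := fun i a => by
    rw [leftFactor_tmul, factorEnd_tprod, (h₁ i).apply_eq, Function.update_eq_self]
  have hr : ∀ i a, rightFactor M₁ V i (τ₂ i a)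
      ((PiTensorProduct.tprod ℂ e₁ ⊗ₜ PiTensorProduct.tprod ℂ e₂) ⊗ₜ v) =
        (PiTensorProduct.tprod ℂ e₁ ⊗ₜ PiTensorProduct.tprod ℂ e₂) ⊗ₜ v := fun i a => by
    rw [rightFactor_tmul, factorEnd_tprod, (h₂ i).apply_eq, Function.update_eq_self]
  let F : Fin m₁ ⊕ Fin m₂ → PlanarGCA →
      Module.End ℂ (((⨂[ℂ] i, M₁ i) ⊗[ℂ] (⨂[ℂ] i, M₂ i)) ⊗[ℂ] V) :=
    Sum.elim (fun i x => leftFactor M₂ V i (LieModule.toEnd ℂ PlanarGCA (M₁ i) x))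
      fun i x => rightFactor M₁ V i (LieModule.toEnd ℂ PlanarGCA (M₂ i) x)
  have hF : ∀ x, LieModule.toEnd ℂ PlanarGCA (((⨂[ℂ] i, M₁ i) ⊗[ℂ] (⨂[ℂ] i, M₂ i)) ⊗[ℂ] V) x =
      ∑ k, F k x + lastFactor M₁ M₂ V (LieModule.toEnd ℂ PlanarGCA V x) := fun x => by
    rw [toEnd_mixedTensor, Fintype.sum_sum_type]
    rfl
  have hl_comm : ∀ i k, k ≠ Sum.inl i → ∀ f x, Commute (leftFactor M₂ V i f) (F k x) := by
    rintro i (k | k) hk f x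
    · exact leftFactor_commute_leftFactor (fun h => hk (congrArg _ h.symm)) f _
    · exact leftFactor_commute_rightFactor i k f _
  have hr_comm : ∀ i k, k ≠ Sum.inr i → ∀ f x, Commute (rightFactor M₁ V i f) (F k x) := by
    rintro i (k | k) hk f x
    · exact (leftFactor_commute_rightFactor k i _ f).symm
    · exact rightFactor_commute_rightFactor (fun h => hk (congrArg _ h.symm)) f _
  rw [Function.Injective] at hμ
  push Not at hμ
  -- The two colliding factors may each belong to either family.
  obtain ⟨i | i, j | j, hij, hne⟩ := hμ
  · replace hij : μ₁ i = μ₁ j := hij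
    exact not_isIrreducible_of_sum (h₁ i) (hij ▸ h₁ j) _ _ hne F _ hF (fun _ => rfl)
      (fun _ => rfl) (leftFactor_commute_leftFactor fun h => hne (congrArg _ h))
      (hl_comm i) (hl_comm j) (fun f _ => leftFactor_commute_lastFactor i f _)
      (fun f _ => leftFactor_commute_lastFactor j f _) hu (hl i) (hl j)
  · replace hij : μ₁ i = μ₂ j := hij
    exact not_isIrreducible_of_sum (h₁ i) (hij ▸ h₂ j) _ _ hne F _ hF (fun _ => rfl)
      (fun _ => rfl) (leftFactor_commute_rightFactor i j)
      (hl_comm i) (hr_comm j) (fun f _ => leftFactor_commute_lastFactor i f _)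
      (fun f _ => rightFactor_commute_lastFactor j f _) hu (hl i) (hr j)
  · replace hij : μ₂ i = μ₁ j := hij
    exact not_isIrreducible_of_sum (h₂ i) (hij ▸ h₁ j) _ _ hne F _ hF (fun _ => rfl)
      (fun _ => rfl) (fun f g => (leftFactor_commute_rightFactor j i g f).symm)
      (hr_comm i) (hl_comm j) (fun f _ => rightFactor_commute_lastFactor i f _)
      (fun f _ => leftFactor_commute_lastFactor j f _) hu (hr i) (hl j)
  · replace hij : μ₂ i = μ₂ j := hij
    exact not_isIrreducible_of_sum (h₂ i) (hij ▸ h₂ j) _ _ hne F _ hF (fun _ => rfl)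
      (fun _ => rfl) (rightFactor_commute_rightFactor fun h => hne (congrArg _ h))
      (hr_comm i) (hr_comm j) (fun f _ => rightFactor_commute_lastFactor i f _)
      (fun f _ => rightFactor_commute_lastFactor j f _) hu (hr i) (hr j)

end Reducible

/-! ### The modules `Omega` and `Gamma` -/

open MvPolynomial

theorem toEnd_omega_gen (lam sig : ℂˣ) (eta : ℂ) (Y : Gen) (n : ℤ) :
    LieModule.toEnd ℂ PlanarGCA (Omega lam sig eta) (gen Y n) = omegaAct lam sig eta Y n :=
  actionLin_gen (omegaAct lam sig eta) Y n

theorem toEnd_gamma_gen (lam sig : ℂˣ) (eta : ℂ) (Y : Gen) (n : ℤ) :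
    LieModule.toEnd ℂ PlanarGCA (Gamma lam sig eta) (gen Y n) = gammaAct lam sig eta Y n :=
  actionLin_gen (gammaAct lam sig eta) Y n

/-- The scalar `lam ^ n * sig` is invertible, so it can be divided out. -/
theorem shiftOp_mem_of_shiftOp_C_mem {R : Subalgebra ℂ (Module.End ℂ (MvPolynomial (Fin 2) ℂ))}
    {lam sig : ℂˣ} {n : ℤ} {ε : ℂ}
    (h : shiftOp ((lam ^ n : ℂˣ) : ℂ) (C (sig : ℂ)) n ε ∈ R) : (shift n ε).toLinearMap ∈ R := by
  have h' := R.smul_mem h (((lam ^ n * sig)⁻¹ : ℂˣ) : ℂ)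
  convert h' using 1
  refine LinearMap.ext fun f => ?_
  rw [LinearMap.smul_apply, shiftOp_apply, ← smul_eq_C_mul, ← smul_eq_C_mul, smul_smul, smul_smul,
    ← Units.val_mul, ← Units.val_mul, mul_assoc, inv_mul_cancel, Units.val_one, one_smul]
  rfl

/-- `L_0` and `H_0` multiply by the variables and `I_n` supplies the translations, with second step
`ε = 1`. -/
theorem exists_mem_eqOn_omegaAct {lam sig : ℂˣ} {eta : ℂ}
    {R : Subalgebra ℂ (Module.End ℂ (MvPolynomial (Fin 2) ℂ))}
    (hR : ∀ Y n, omegaAct lam sig eta Y n ∈ R) (g : Module.End ℂ (MvPolynomial (Fin 2) ℂ))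
    (s : Finset (MvPolynomial (Fin 2) ℂ)) : ∃ r ∈ R, ∀ f ∈ s, r f = g f := by
  have hL : omegaAct lam sig eta .L 0 = LinearMap.mulLeft ℂ (X 0) :=
    LinearMap.ext fun f => by simp [omegaAct, shiftOp_apply, shift_zero]
  have hH : omegaAct lam sig eta .H 0 = LinearMap.mulLeft ℂ (X 1) :=
    LinearMap.ext fun f => by simp [omegaAct, shiftOp_apply, shift_zero]
  exact exists_mem_eqOn one_ne_zero (hL ▸ hR .L 0) (hH ▸ hR .H 0)
    (fun n => shiftOp_mem_of_shiftOp_C_mem (hR .I n)) g s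

theorem isExpDense_omega (lam sig : ℂˣ) (eta : ℂ) : IsExpDense lam (Omega lam sig eta) where
  nontrivial := inferInstanceAs (Nontrivial (MvPolynomial (Fin 2) ℂ))
  isExpPoly Y m := by
    have h := isExpPoly_omegaAct lam sig eta Y m
    simp only [← toEnd_omega_gen] at h
    exact h
  dense R hR := by
    simp only [toEnd_omega_gen] at hR
    exact exists_mem_eqOn_omegaAct hR

/-- Here `J_n` supplies the translations, with second step `ε = -1`. -/
theorem exists_mem_eqOn_gammaAct {lam sig : ℂˣ} {eta : ℂ}
    {R : Subalgebra ℂ (Module.End ℂ (MvPolynomial (Fin 2) ℂ))}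
    (hR : ∀ Y n, gammaAct lam sig eta Y n ∈ R) (g : Module.End ℂ (MvPolynomial (Fin 2) ℂ))
    (s : Finset (MvPolynomial (Fin 2) ℂ)) : ∃ r ∈ R, ∀ f ∈ s, r f = g f := by
  have hL : gammaAct lam sig eta .L 0 = LinearMap.mulLeft ℂ (X 0) :=
    LinearMap.ext fun f => by simp [gammaAct, shiftOp_apply, shift_zero]
  have hH : gammaAct lam sig eta .H 0 = LinearMap.mulLeft ℂ (X 1) :=
    LinearMap.ext fun f => by simp [gammaAct, shiftOp_apply, shift_zero]
  exact exists_mem_eqOn (neg_ne_zero.2 one_ne_zero) (hL ▸ hR .L 0) (hH ▸ hR .H 0)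
    (fun n => shiftOp_mem_of_shiftOp_C_mem (hR .J n)) g s

theorem isExpDense_gamma (lam sig : ℂˣ) (eta : ℂ) : IsExpDense lam (Gamma lam sig eta) where
  nontrivial := inferInstanceAs (Nontrivial (MvPolynomial (Fin 2) ℂ))
  isExpPoly Y m := by
    have h := isExpPoly_gammaAct lam sig eta Y m
    simp only [← toEnd_gamma_gen] at h
    exact h
  dense R hR := by
    simp only [toEnd_gamma_gen] at hR
    exact exists_mem_eqOn_gammaAct hR

/-- The translations of the first variable of `ℂ[X₀, X₁]`, on the module `Omega`. -/
noncomputable def omegaShift (lam sig : ℂˣ) (eta : ℂ) (a : ℤ) : Module.End ℂ (Omega lam sig eta) :=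
  (shift a 0).toLinearMap

/-- The constant polynomial `1` as an element of the module `Omega`. -/
noncomputable def omegaOne (lam sig : ℂˣ) (eta : ℂ) : Omega lam sig eta :=
  (1 : MvPolynomial (Fin 2) ℂ)

theorem isShiftFamily_omega (lam sig : ℂˣ) (eta : ℂ) :
    IsShiftFamily lam (Omega lam sig eta) (omegaShift lam sig eta) (omegaOne lam sig eta) where
  ne_zero := one_ne_zero (α := MvPolynomial (Fin 2) ℂ)
  apply_eq a := map_one (shift a 0)
  mul_toEnd_L a n := by
    rw [toEnd_omega_gen]
    refine LinearMap.ext fun (f : MvPolynomial (Fin 2) ℂ) => ?_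
    change shift a 0 (omegaAct lam sig eta .L n f) = omegaAct lam sig eta .L n (shift a 0 f) -
      ((a : ℂ) * (lam ^ n : ℂˣ)) • shift ((a + n : ℤ) : ℂ) 0 f
    simp only [omegaAct, shiftOp_apply, map_mul, map_add, map_sub, shift_X0, shift_X1, shift_C,
      shift_shift, smul_eq_C_mul, Int.cast_add, add_zero, map_zero, sub_zero,
      add_comm (n : ℂ) (a : ℂ)]
    ring
  commute Y hY a n := by
    rw [toEnd_omega_gen]
    refine LinearMap.ext fun (f : MvPolynomial (Fin 2) ℂ) => ?_
    change shift a 0 (omegaAct lam sig eta Y n f) = omegaAct lam sig eta Y n (shift a 0 f)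
    cases Y <;>
      simp_all [omegaAct, shiftOp_apply, shift_X1, shift_shift, add_comm (n : ℂ) (a : ℂ)]

/-- The translations of the first variable of `ℂ[X₀, X₁]`, on the module `Gamma`. -/
noncomputable def gammaShift (lam sig : ℂˣ) (eta : ℂ) (a : ℤ) : Module.End ℂ (Gamma lam sig eta) :=
  (shift a 0).toLinearMap

/-- The constant polynomial `1` as an element of the module `Gamma`. -/
noncomputable def gammaOne (lam sig : ℂˣ) (eta : ℂ) : Gamma lam sig eta :=
  (1 : MvPolynomial (Fin 2) ℂ)

theorem isShiftFamily_gamma (lam sig : ℂˣ) (eta : ℂ) :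
    IsShiftFamily lam (Gamma lam sig eta) (gammaShift lam sig eta) (gammaOne lam sig eta) where
  ne_zero := one_ne_zero (α := MvPolynomial (Fin 2) ℂ)
  apply_eq a := map_one (shift a 0)
  mul_toEnd_L a n := by
    rw [toEnd_gamma_gen]
    refine LinearMap.ext fun (f : MvPolynomial (Fin 2) ℂ) => ?_
    change shift a 0 (gammaAct lam sig eta .L n f) = gammaAct lam sig eta .L n (shift a 0 f) -
      ((a : ℂ) * (lam ^ n : ℂˣ)) • shift ((a + n : ℤ) : ℂ) 0 f
    simp only [gammaAct, shiftOp_apply, map_mul, map_add, shift_X0, shift_X1, shift_C,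
      shift_shift, smul_eq_C_mul, Int.cast_add, add_zero, map_zero, sub_zero,
      add_comm (n : ℂ) (a : ℂ)]
    ring
  commute Y hY a n := by
    rw [toEnd_gamma_gen]
    refine LinearMap.ext fun (f : MvPolynomial (Fin 2) ℂ) => ?_
    change shift a 0 (gammaAct lam sig eta Y n f) = gammaAct lam sig eta Y n (shift a 0 f)
    cases Y <;>
      simp_all [gammaAct, shiftOp_apply, shift_X1, shift_shift, add_comm (n : ℂ) (a : ℂ)]

theorem injective_sumElim_iff {m₁ m₂ : ℕ} {A : Type*} (lam : Fin (m₁ + m₂) → A) :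
    Function.Injective (Sum.elim (fun k : Fin m₁ => lam (Fin.castAdd m₂ k))
      fun k : Fin m₂ => lam (Fin.natAdd m₁ k)) ↔ ∀ i j, i ≠ j → lam i ≠ lam j := by
  have h : Sum.elim (fun k : Fin m₁ => lam (Fin.castAdd m₂ k))
      (fun k : Fin m₂ => lam (Fin.natAdd m₁ k)) = lam ∘ finSumFinEquiv := by
    funext k
    cases k <;> simp
  rw [h, finSumFinEquiv.injective_comp]
  exact ⟨fun h i j hij => h.ne hij, fun h i j => not_imp_not.1 (h i j)⟩

end PlanarGCA

theorem theorem3p3 (m₁ m₂ : ℕ) (lam sig : Fin (m₁ + m₂) → ℂˣ) (eta : Fin (m₁ + m₂) → ℂ)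
    (V : Type*) [AddCommGroup V] [Module ℂ V] [LieRingModule PlanarGCA V]
    [LieModule ℂ PlanarGCA V] (hsimple : LieModule.IsIrreducible ℂ PlanarGCA V)
    (hrestricted : PlanarGCA.IsRestricted V) :
    LieModule.IsIrreducible ℂ PlanarGCA (PlanarGCA.TensorModule m₁ m₂ lam sig eta V) ↔
      ∀ i j : Fin (m₁ + m₂), i ≠ j → lam i ≠ lam j := by
  have : Nontrivial V := (LieSubmodule.nontrivial_iff ℂ PlanarGCA V).1 inferInstance
  rw [← PlanarGCA.injective_sumElim_iff]
  constructor
  · intro h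
    by_contra hlam
    exact PlanarGCA.not_isIrreducible_mixedTensor
      (fun i => PlanarGCA.isShiftFamily_omega _ _ _)
      (fun i => PlanarGCA.isShiftFamily_gamma _ _ _) hlam h
  · exact PlanarGCA.isIrreducible_mixedTensor (fun i => PlanarGCA.isExpDense_omega _ _ _)
      (fun i => PlanarGCA.isExpDense_gamma _ _ _) hrestricted
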